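/- **Definitions.** A *ribbon graph* with $n$ faces is given by a finite non-empty set $X$ (oriented edges) with a permutation $s_0$ all of whose cycles have length at least $3$, a fixed-point-free involution $s_1$, such that $\langle s_0,s_1\rangle$ acts transitively on $X$, and a labelling by $n$ labels of the cycles of $s_2=s_1s_0^{-1}$. The vertices, edges and faces are the cycles of $s_0$, $s_1$ and $s_2$; here $s_0$ rotates anticlockwise the oriented edges pointing toward a vertex, $s_1$ reverses oriented edges, and $s_2x$ is the edge following $x$ along the face to its left. A *metric ribbon graph* $\widetilde\Gamma$ is a ribbon graph with a positive length $\ell_e$ for each edge $e$; it is regarded as a compact metric space with its path metric. For $N>0$, $N\widetilde\Gamma$ has the edge lengths $N\ell_e$. For $\lambda>0$ and a metric space $Y$, $\lambda Y$ is $Y$ with its metric multiplied by $\lambda$. Let positive numbers $\rho_v$ be assigned to the vertices $v$ of $\widetilde\Gamma$. For each oriented edge $x$ from $u$ to $v$, let $Q_x$ be the hyperbolic quadrilateral with a base of length $\ell_x$, two right angles at the ends of the base, and sides (*ribs*) of length $\rho_u$ and $\rho_v$ perpendicular to the base at its tail and head end; $Q_x$ lies to the left of $x$, with the fourth side playing the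 role of the edge $x$. Call $(\rho_v)$ a *system of rib lengths* if, at every vertex $v$, the angles of the corners of these quadrilaterals lying at $v$ add up to $2\pi$. For a system of rib lengths, gluing isometrically the fourth sides of $Q_x$ and $Q_{s_1x}$ (reversing direction) and the head rib of $Q_x$ to the tail rib of $Q_{s_2x}$, for all $x$, gives the compact hyperbolic surface with geodesic boundary $S(\widetilde\Gamma)$ with spine $\widetilde\Gamma$, endowed with its path metric; $Q_x$ and $Q_{s_1x}$ together form the hexagon with four right angles around the edge $x$ into which $S(\widetilde\Gamma)$ is cut by the ribs. This is the inverse Bowditch–Epstein construction. **Theorem 5.6.** For every metric ribbon graph $\widetilde\Gamma$ and every real $N>0$, $N\widetilde\Gamma$ has exactly one system of rib lengths (so that $S(N\widetilde\Gamma)$ is well defined), and $$\lim_{N\to\infty}\tfrac1N\,S(N\widetilde\Gamma)=\widetilde\Gamma$$ in the Gromov–Hausdorff topology. -/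

import Mathlib

open scoped ENNReal UpperHalfPlane
open Filter Topology

noncomputable section

/-! ## Ribbon graphs -/

/-- A (connected, labelled) ribbon graph with `n` faces whose set of oriented edges is `X`.
The permutation `s₀` rotates the oriented edges pointing toward a common vertex anticlockwise, and
`s₁` reverses oriented edges.  All cycles of `s₀` have length at least three (every vertex has degree
at least three) and `s₁` is an involution without fixed points.  Since a ribbon graph is
the `1`-skeleton of a cell decomposition of a connected surface, `s₀` and `s₁` together act
transitively. The faces, i.e. the cycles of `s₂ = s₁ s₀⁻¹`, are labelled by `n` labels. -/
structure RibbonGraph (X : Type*) (n : ℕ) where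
  s₀ : Equiv.Perm X
  s₁ : Equiv.Perm X
  s₀_ne : ∀ x, s₀ x ≠ x
  s₀_s₀_ne : ∀ x, s₀ (s₀ x) ≠ x
  s₁_s₁ : ∀ x, s₁ (s₁ x) = x
  s₁_ne : ∀ x, s₁ x ≠ x
  connected : ∀ x y, ∃ g ∈ Subgroup.closure {s₀, s₁}, g x = y
  label : Quotient (Equiv.Perm.SameCycle.setoid (s₁ * s₀⁻¹)) ≃ Fin n

namespace RibbonGraph

variable {X : Type*} {n : ℕ}

/-- Vertices are the cycles of `s₀`. -/
def Vertex (G : RibbonGraph X n) : Type _ := Quotient (Equiv.Perm.SameCycle.setoid G.s₀)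

/-- Unoriented edges are the cycles of `s₁`. -/
def Edge (G : RibbonGraph X n) : Type _ := Quotient (Equiv.Perm.SameCycle.setoid G.s₁)

/-- `s₂ x` is the oriented edge that follows `x` along the face on the left of `x`. -/
def s₂ (G : RibbonGraph X n) : Equiv.Perm X := G.s₁ * G.s₀⁻¹

/-- The vertex toward which the oriented edge `x` points. -/
def head (G : RibbonGraph X n) (x : X) : G.Vertex :=
  Quotient.mk (Equiv.Perm.SameCycle.setoid G.s₀) x

/-- The vertex from which the oriented edge `x` emanates. -/
def tail (G : RibbonGraph X n) (x : X) : G.Vertex := G.head (G.s₁ x)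

/-- The unoriented edge underlying the oriented edge `x`. -/
def edge (G : RibbonGraph X n) (x : X) : G.Edge :=
  Quotient.mk (Equiv.Perm.SameCycle.setoid G.s₁) x

theorem head_s₀ (G : RibbonGraph X n) (x : X) : G.head (G.s₀ x) = G.head x :=
  Quotient.sound (s := Equiv.Perm.SameCycle.setoid G.s₀)
    (Equiv.Perm.sameCycle_apply_left.2 (Equiv.Perm.SameCycle.refl _ _))

theorem tail_s₁ (G : RibbonGraph X n) (x : X) : G.tail (G.s₁ x) = G.head x := by
  rw [tail, G.s₁_s₁]

/-- An equivalence relation that is compatible with `s₀` and `s₁` has a single class. -/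
theorem rel_of_connected (G : RibbonGraph X n) {r : X → X → Prop} (hr : Equivalence r)
    (h0 : ∀ x, r x (G.s₀ x)) (h1 : ∀ x, r x (G.s₁ x)) (x y : X) : r x y := by
  obtain ⟨g, hg, hy⟩ := G.connected x y
  rw [← hy]
  clear hy y
  revert x
  induction hg using Subgroup.closure_induction with
  | mem g hg =>
    rcases hg with rfl | rfl
    · exact h0
    · exact h1
  | one => exact fun x => hr.refl x
  | mul a b _ _ ha hb => exact fun x => hr.trans (hb x) (ha (b x))
  | inv a _ ha =>
    intro x
    have := ha (a⁻¹ x)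
    have hx : a (a⁻¹ x) = x := Equiv.apply_symm_apply a x
    rw [hx] at this
    exact hr.symm this

end RibbonGraph

/-- A metric ribbon graph: a ribbon graph with a positive real number assigned to each edge. -/
structure MetricRibbonGraph (X : Type*) (n : ℕ) extends RibbonGraph X n where
  edgeLength : toRibbonGraph.Edge → ℝ
  edgeLength_pos : ∀ e, 0 < edgeLength e

/-- Positive real numbers (scale factors). -/
abbrev PosReal : Type := {c : ℝ // 0 < c}

namespace MetricRibbonGraph

variable {X : Type*} {n : ℕ}

/-- The length of the edge underlying an oriented edge. -/
def len (G : MetricRibbonGraph X n) (x : X) : ℝ := G.edgeLength (G.edge x)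

theorem len_pos (G : MetricRibbonGraph X n) (x : X) : 0 < G.len x := G.edgeLength_pos _

theorem len_s₁ (G : MetricRibbonGraph X n) (x : X) : G.len (G.s₁ x) = G.len x := by
  have : G.edge (G.s₁ x) = G.edge x :=
    Quotient.sound (s := Equiv.Perm.SameCycle.setoid G.s₁)
      (Equiv.Perm.sameCycle_apply_left.2 (Equiv.Perm.SameCycle.refl _ _))
  rw [len, this, len]

/-- The metric ribbon graph `N Γ`, all of whose edges are `N` times as long as those of `Γ`. -/
def scale (N : PosReal) (G : MetricRibbonGraph X n) : MetricRibbonGraph X n where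
  toRibbonGraph := G.toRibbonGraph
  edgeLength e := N * G.edgeLength e
  edgeLength_pos e := mul_pos N.2 (G.edgeLength_pos e)

end MetricRibbonGraph

/-! ## Gluing metric spaces -/

/-- Instructions for gluing: a family of subsets `piece i` of a metric space `Y`, and a relation
saying which points of the disjoint union of the pieces are identified: `glue i y j z` says that the
point `y` of `piece i` is identified with the point `z` of `piece j`. -/
structure GluingData (ι Y : Type*) where
  piece : ι → Set Y
  glue : ι → Y → ι → Y → Prop

namespace GluingData

variable {ι Y : Type*}

/-- The disjoint union of the pieces. -/
structure Point (D : GluingData ι Y) where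
  idx : ι
  pt : Y
  mem : pt ∈ D.piece idx

variable [PseudoEMetricSpace Y] (D : GluingData ι Y)

open Classical in
/-- The cost of a single step in the disjoint union of the pieces: moving between glued
points is free, moving within a piece costs the distance, and other steps are not allowed. -/
def step (p q : D.Point) : ℝ≥0∞ :=
  if D.glue p.idx p.pt q.idx q.pt ∨ D.glue q.idx q.pt p.idx p.pt then 0
  else if p.idx = q.idx then edist p.pt q.pt else ⊤

/-- The total cost of the chain of steps from `p` to `q` through the points of a list. -/
def chainLength : D.Point → List D.Point → D.Point → ℝ≥0∞
  | p, [], q => D.step p q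
  | p, a :: l, q => D.step p a + chainLength a l q

theorem step_self (p : D.Point) : D.step p p = 0 := by
  unfold step; split_ifs <;> simp_all

theorem step_comm (p q : D.Point) : D.step p q = D.step q p := by
  unfold step
  rw [edist_comm p.pt q.pt]
  congr 1
  · exact propext or_comm
  · congr 1
    exact propext eq_comm

theorem chainLength_append (p : D.Point) (l : List D.Point) (q : D.Point) (m : List D.Point)
    (r : D.Point) :
    D.chainLength p (l ++ q :: m) r = D.chainLength p l q + D.chainLength q m r := by
  induction l generalizing p with
  | nil => rfl
  | cons a l ih => simp only [List.cons_append, chainLength, ih, add_assoc]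

theorem chainLength_reverse (p : D.Point) (l : List D.Point) (q : D.Point) :
    D.chainLength q l.reverse p = D.chainLength p l q := by
  induction l generalizing p with
  | nil => exact D.step_comm _ _
  | cons a l ih =>
    rw [List.reverse_cons, chainLength_append, ih]
    simp only [chainLength]
    rw [add_comm, D.step_comm]

/-- The gluing (quotient) pseudo-distance: the infimum of the costs of all chains. -/
instance : PseudoEMetricSpace D.Point where
  edist p q := ⨅ l : List D.Point, D.chainLength p l q
  edist_self p := le_antisymm (iInf_le_of_le [] (D.step_self p).le) zero_le
  edist_comm p q := by
    apply le_antisymm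
    · exact le_iInf fun l => iInf_le_of_le l.reverse (D.chainLength_reverse q l p).le
    · exact le_iInf fun l => iInf_le_of_le l.reverse (D.chainLength_reverse p l q).le
  edist_triangle p q r := by
    change _ ≤ (⨅ l : List D.Point, D.chainLength p l q) + ⨅ m : List D.Point, D.chainLength q m r
    rw [ENNReal.iInf_add]
    refine le_iInf fun l => ?_
    rw [ENNReal.add_iInf]
    exact le_iInf fun m => iInf_le_of_le (l ++ q :: m) (D.chainLength_append p l q m r).le

/-- The glued space: points of the disjoint union at distance zero are identified. -/
def Space : Type _ := SeparationQuotient D.Point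

instance : EMetricSpace D.Space := inferInstanceAs (EMetricSpace (SeparationQuotient D.Point))

theorem edist_le_step (p q : D.Point) : edist p q ≤ D.step p q := iInf_le_of_le [] le_rfl

theorem edist_le_of_piece {i : ι} {y z : Y} (hy : y ∈ D.piece i) (hz : z ∈ D.piece i) :
    edist (⟨i, y, hy⟩ : D.Point) ⟨i, z, hz⟩ ≤ edist y z := by
  refine (D.edist_le_step _ _).trans ?_
  unfold step
  split_ifs <;> simp_all

theorem edist_eq_zero_of_glue {p q : D.Point} (h : D.glue p.idx p.pt q.idx q.pt) : edist p q = 0 := by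
  refine le_antisymm ((D.edist_le_step _ _).trans ?_) zero_le
  simp [step, h]

theorem compactSpace [Finite ι] (h : ∀ i, IsCompact (D.piece i)) : CompactSpace D.Space := by
  have hmk : Continuous (SeparationQuotient.mk : D.Point → SeparationQuotient D.Point) :=
    SeparationQuotient.continuous_mk
  let f : (i : ι) → D.piece i → SeparationQuotient D.Point :=
    fun i y => SeparationQuotient.mk (⟨i, y.1, y.2⟩ : D.Point)
  have hf : ∀ i, Continuous (f i) := by
    intro i
    refine hmk.comp ?_
    have : LipschitzWith 1 (fun y : D.piece i => (⟨i, y.1, y.2⟩ : D.Point)) := by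
      intro y z
      rw [ENNReal.coe_one, one_mul]
      exact D.edist_le_of_piece y.2 z.2
    exact this.continuous
  have huniv : (⋃ i, Set.range (f i)) = Set.univ := by
    refine Set.eq_univ_of_forall fun q => ?_
    obtain ⟨⟨i, y, hy⟩, rfl⟩ := SeparationQuotient.surjective_mk q
    exact Set.mem_iUnion.2 ⟨i, ⟨⟨y, hy⟩, rfl⟩⟩
  have : CompactSpace (SeparationQuotient D.Point) := by
    refine ⟨?_⟩
    rw [← huniv]
    refine isCompact_iUnion fun i => ?_
    have : CompactSpace (D.piece i) := isCompact_iff_compactSpace.1 (h i)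
    exact isCompact_range (hf i)
  exact this

end GluingData

/-! ## Rescaling a metric space -/

/-- `Rescaled c X` is the metric space `c X`, that is `X` with its metric multiplied by `c`. -/
structure Rescaled (c : PosReal) (X : Type*) where
  of ::
  val : X

namespace Rescaled

variable {c : PosReal} {X : Type*}

instance [MetricSpace X] : MetricSpace (Rescaled c X) where
  dist p q := c * dist p.val q.val
  dist_self p := by simp
  dist_comm p q := by rw [dist_comm]
  dist_triangle p q r := by
    rw [← mul_add]
    exact mul_le_mul_of_nonneg_left (dist_triangle _ _ _) c.2.le
  eq_of_dist_eq_zero {p q} h := by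
    have : p.val = q.val := dist_eq_zero.1 ((mul_eq_zero.1 h).resolve_left c.2.ne')
    cases p; cases q; simp_all

instance [Nonempty X] : Nonempty (Rescaled c X) := ⟨⟨Classical.arbitrary X⟩⟩

instance [MetricSpace X] [CompactSpace X] : CompactSpace (Rescaled c X) := by
  have hf : LipschitzWith ⟨c, c.2.le⟩ (Rescaled.of : X → Rescaled c X) :=
    LipschitzWith.of_dist_le_mul fun _ _ => le_rfl
  have hs : Function.Surjective (Rescaled.of : X → Rescaled c X) := fun p => ⟨p.val, rfl⟩
  exact hs.compactSpace hf.continuous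

end Rescaled

/-! ## The metric graph -/

namespace MetricRibbonGraph

variable {X : Type*} {n : ℕ}

/-- The metric graph is glued from one interval `[0, len x]` for each oriented edge `x`,
parametrised from the tail of `x` to its head: the intervals of `x` and of its reverse are
identified, and end points at the same vertex are identified. -/
def graphGluing (G : MetricRibbonGraph X n) : GluingData X ℝ where
  piece x := Set.Icc 0 (G.len x)
  glue x a y b := (y = G.s₁ x ∧ a + b = G.len x) ∨
    (G.head x = G.head y ∧ a = G.len x ∧ b = G.len y)

/-- The metric graph underlying a metric ribbon graph, with its path metric. -/
def Graph (G : MetricRibbonGraph X n) : Type _ := G.graphGluing.Space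

theorem graph_edist_ne_top (G : MetricRibbonGraph X n) (p q : G.Graph) :
    @edist _ (inferInstanceAs (EDist G.graphGluing.Space)) p q ≠ ⊤ := by
  let e : X → G.graphGluing.Point := fun x => ⟨x, G.len x, ⟨(G.len_pos x).le, le_rfl⟩⟩
  have key : ∀ x y, edist (e x) (e y) < ⊤ := by
    refine G.rel_of_connected (r := fun x y => edist (e x) (e y) < ⊤) ?_ ?_ ?_
    · refine ⟨fun x => by simp, fun {x y} h => by rwa [edist_comm], fun {x y z} h h' => ?_⟩
      exact (edist_triangle _ (e y) _).trans_lt (ENNReal.add_lt_top.2 ⟨h, h'⟩)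
    · intro x
      rw [G.graphGluing.edist_eq_zero_of_glue (Or.inr ⟨(G.head_s₀ x).symm, rfl, rfl⟩)]
      exact ENNReal.zero_lt_top
    · intro x
      have h0 : (0 : ℝ) ∈ G.graphGluing.piece (G.s₁ x) := ⟨le_rfl, (G.len_pos _).le⟩
      refine (edist_triangle _ (⟨G.s₁ x, 0, h0⟩ : G.graphGluing.Point) _).trans_lt ?_
      refine ENNReal.add_lt_top.2 ⟨?_, ?_⟩
      · rw [G.graphGluing.edist_eq_zero_of_glue (Or.inl ⟨rfl, by simp [e]⟩)]
        exact ENNReal.zero_lt_top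
      · exact (G.graphGluing.edist_le_of_piece _ _).trans_lt (edist_lt_top _ _)
  have toe : ∀ p : G.graphGluing.Point, edist p (e p.idx) < ⊤ := fun p =>
    (G.graphGluing.edist_le_of_piece p.mem _).trans_lt (edist_lt_top _ _)
  obtain ⟨p, rfl⟩ := SeparationQuotient.surjective_mk p
  obtain ⟨q, rfl⟩ := SeparationQuotient.surjective_mk q
  refine ne_of_lt (b := ⊤) (?_ : edist p q < ⊤)
  refine (edist_triangle _ (e p.idx) _).trans_lt (ENNReal.add_lt_top.2 ⟨toe p, ?_⟩)
  refine (edist_triangle _ (e q.idx) _).trans_lt (ENNReal.add_lt_top.2 ⟨key _ _, ?_⟩)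
  rw [edist_comm]
  exact toe q

instance (G : MetricRibbonGraph X n) : MetricSpace G.Graph :=
  @EMetricSpace.toMetricSpace _ (inferInstanceAs (EMetricSpace G.graphGluing.Space))
    G.graph_edist_ne_top

instance [Finite X] (G : MetricRibbonGraph X n) : CompactSpace G.Graph :=
  G.graphGluing.compactSpace fun _ => isCompact_Icc

instance [Nonempty X] (G : MetricRibbonGraph X n) : Nonempty G.Graph :=
  ⟨SeparationQuotient.mk (⟨Classical.arbitrary X, 0, ⟨le_rfl, (G.len_pos _).le⟩⟩ :
    G.graphGluing.Point)⟩

end MetricRibbonGraph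

/-! ## Hyperbolic quadrilaterals -/

namespace Hyp

/-- Fermi coordinates relative to the geodesic `i ℝ₊`: the point at signed distance `s` from the
point `i eᵗ`, on the geodesic perpendicular to `i ℝ₊` at that point, on the right for `s > 0`. -/
def fermi (t s : ℝ) : ℍ :=
  ⟨⟨Real.exp t * Real.tanh s, Real.exp t / Real.cosh s⟩, div_pos (Real.exp_pos _) (Real.cosh_pos _)⟩

/-- The geodesic segment between two points of the hyperbolic plane. -/
def seg (a b : ℍ) : Set ℍ := {z | dist a z + dist z b = dist a b}

/-- The foot of the perpendicular from `z` to the geodesic `i ℝ₊`. -/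
def foot (z : ℍ) : ℍ := ⟨⟨0, ‖(z : ℂ)‖⟩, norm_pos_iff.2 z.ne_zero⟩

/-- The position of `a` in the Poincaré disc centred at `z`. Geodesics issuing from `z` are radii
of this disc. -/
def diskCoord (z a : ℍ) : ℂ := ((a : ℂ) - z) / ((a : ℂ) - starRingEnd ℂ (z : ℂ))

/-- The hyperbolic angle at `z` between the geodesics from `z` to `a` and from `z` to `b`. -/
def angle (a z b : ℍ) : ℝ := InnerProductGeometry.angle (diskCoord z a) (diskCoord z b)

/-- The hyperbolic quadrilateral with right angles at the end points of the base, which is the segment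
of length `ℓ` from `i` to `i e^ℓ`, whose two remaining vertices lie at distances `r` and `r'`
from these end points: the union of all perpendiculars from the side opposite to the base (the
diagonal of the hexagon obtained by reflecting the quadrilateral in that side) to the base. -/
def quad (ℓ r r' : ℝ) : Set ℍ := {z | ∃ y ∈ seg (fermi 0 r) (fermi ℓ r'), z ∈ seg (foot y) y}

theorem left_mem_seg (a b : ℍ) : a ∈ seg a b := by simp [seg]

theorem right_mem_seg (a b : ℍ) : b ∈ seg a b := by simp [seg]

theorem continuous_foot : Continuous foot := by
  apply UpperHalfPlane.isEmbedding_coe.continuous_iff.2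
  have : Continuous fun z : ℍ => ((‖(z : ℂ)‖ : ℝ) : ℂ) * Complex.I :=
    (Complex.continuous_ofReal.comp UpperHalfPlane.continuous_coe.norm).mul continuous_const
  convert this using 2 with z
  simp [foot, Complex.ext_iff]

theorem isCompact_seg (a b : ℍ) : IsCompact (seg a b) := by
  apply Metric.isCompact_of_isClosed_isBounded
  · exact isClosed_eq (by fun_prop) continuous_const
  · refine (Metric.isBounded_closedBall (x := a) (r := dist a b)).subset fun z hz => ?_
    rw [Metric.mem_closedBall, dist_comm]
    have h : dist a z + dist z b = dist a b := hz
    linarith [dist_nonneg (x := z) (y := b)]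

theorem isCompact_quad (ℓ r r' : ℝ) : IsCompact (quad ℓ r r') := by
  set K := seg (fermi 0 r) (fermi ℓ r') with hK
  have hKc : IsCompact K := isCompact_seg _ _
  obtain ⟨C, hC⟩ := (hKc.image (continuous_foot.dist continuous_id)).bddAbove
  obtain ⟨R, hR⟩ := hKc.isBounded.subset_closedBall UpperHalfPlane.I
  let T : Set (ℍ × ℍ) := {p | p.1 ∈ K ∧ p.2 ∈ seg (foot p.1) p.1}
  have hT : IsCompact T := by
    apply Metric.isCompact_of_isClosed_isBounded
    · refine (hKc.isClosed.preimage continuous_fst).inter ?_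
      have hf : Continuous fun p : ℍ × ℍ => foot p.1 := continuous_foot.comp continuous_fst
      exact isClosed_eq (by fun_prop) (by fun_prop)
    · refine ((Metric.isBounded_closedBall (x := UpperHalfPlane.I) (r := R)).prod
        (Metric.isBounded_closedBall (x := UpperHalfPlane.I) (r := C + R))).subset ?_
      rintro ⟨y, z⟩ ⟨hy, hz⟩
      have h1 : dist y UpperHalfPlane.I ≤ R := hR hy
      have h2 : dist (foot y) y ≤ C := hC ⟨y, hy, rfl⟩
      have h3 : dist (foot y) z + dist z y = dist (foot y) y := hz
      refine ⟨h1, ?_⟩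
      rw [Metric.mem_closedBall]
      linarith [dist_triangle z y UpperHalfPlane.I, dist_nonneg (x := foot y) (y := z)]
  convert hT.image continuous_snd using 1
  ext z
  constructor
  · rintro ⟨y, hy, hz⟩
    exact ⟨(y, z), ⟨hy, hz⟩, rfl⟩
  · rintro ⟨⟨y, z⟩, ⟨hy, hz⟩, rfl⟩
    exact ⟨y, hy, hz⟩

end Hyp

/-! ## The inverse Bowditch–Epstein construction -/

namespace MetricRibbonGraph

variable {X : Type*} {n : ℕ}

section Pieces

variable (G : MetricRibbonGraph X n) (ρ : G.Vertex → ℝ) (x : X)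

/-- The quadrilateral on the left of the oriented edge `x`, given the lengths `ρ` of the ribs at the
vertices: its base is the boundary arc facing `x`, its right angles are at the end points of the
base, its sides adjacent to the base are ribs at the tail and the head of `x`, and the side opposite
to the base is the edge `x` of the spine.  Together with the quadrilateral of the reverse of `x` it
makes up a hexagon with four right angles. -/
def piece : Set ℍ := Hyp.quad (G.len x) (ρ (G.tail x)) (ρ (G.head x))

/-- The end points of the base. -/
def tailFoot (_G : MetricRibbonGraph X n) (_x : X) : ℍ := Hyp.fermi 0 0

def headFoot : ℍ := Hyp.fermi (G.len x) 0

/-- The corner at the tail of `x`. -/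
def tailCorner : ℍ := Hyp.fermi 0 (ρ (G.tail x))

/-- The corner at the head of `x`. -/
def headCorner : ℍ := Hyp.fermi (G.len x) (ρ (G.head x))

/-- The rib at the tail of `x`, as a side of the quadrilateral of `x`. -/
def tailRib : Set ℍ := Hyp.seg (G.tailFoot x) (G.tailCorner ρ x)

/-- The rib at the head of `x`, as a side of the quadrilateral of `x`. -/
def headRib : Set ℍ := Hyp.seg (G.headFoot x) (G.headCorner ρ x)

/-- The edge of the spine, as a side of the quadrilateral of `x`. -/
def spineSide : Set ℍ := Hyp.seg (G.tailCorner ρ x) (G.headCorner ρ x)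

/-- The angle of the quadrilateral of `x` at its corner at the tail of `x`. -/
def tailAngle : ℝ := Hyp.angle (G.tailFoot x) (G.tailCorner ρ x) (G.headCorner ρ x)

/-- The angle of the quadrilateral of `x` at its corner at the head of `x`. -/
def headAngle : ℝ := Hyp.angle (G.headFoot x) (G.headCorner ρ x) (G.tailCorner ρ x)

theorem tailCorner_mem_piece : G.tailCorner ρ x ∈ G.piece ρ x :=
  ⟨_, Hyp.left_mem_seg _ _, Hyp.right_mem_seg _ _⟩

theorem headCorner_mem_piece : G.headCorner ρ x ∈ G.piece ρ x :=
  ⟨_, Hyp.right_mem_seg _ _, Hyp.right_mem_seg _ _⟩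

end Pieces

open Classical in
/-- `ρ` is a system of rib lengths for `G`: positive numbers assigned to the vertices such that the
corners of the quadrilaterals which meet at a vertex have total angle `2π`.  At the
vertex `v` these are, for each oriented edge `x` pointing toward `v`, the corner at the head of
`x` and the corner at the tail of the reverse of `x`. -/
def IsRibLengths [Fintype X] (G : MetricRibbonGraph X n) (ρ : G.Vertex → ℝ) : Prop :=
  (∀ v, 0 < ρ v) ∧ ∀ v : G.Vertex,
    ∑ x ∈ Finset.univ.filter (fun x => G.head x = v),
      (G.headAngle ρ x + G.tailAngle ρ (G.s₁ x)) = 2 * Real.pi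

/-- The gluing of the quadrilaterals.  The spine sides of `x` and of its reverse are glued
isometrically, so that the tail of `x` matches the head of its reverse; the rib at the head of `x` is
glued isometrically to the rib at the tail of the next edge `s₂ x` along the face on the left, corner
to corner. -/
def surfaceGluing (G : MetricRibbonGraph X n) (ρ : G.Vertex → ℝ) : GluingData X ℍ where
  piece := G.piece ρ
  glue x a y b :=
    (y = G.s₁ x ∧ a ∈ G.spineSide ρ x ∧ b ∈ G.spineSide ρ y ∧
      dist a (G.tailCorner ρ x) = dist b (G.headCorner ρ y)) ∨
    (y = G.s₂ x ∧ a ∈ G.headRib ρ x ∧ b ∈ G.tailRib ρ y ∧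
      dist a (G.headCorner ρ x) = dist b (G.tailCorner ρ y))

/-- The surface obtained from the quadrilaterals with rib lengths `ρ`, with its path metric. -/
def GluedSurface (G : MetricRibbonGraph X n) (ρ : G.Vertex → ℝ) : Type _ :=
  (G.surfaceGluing ρ).Space

theorem surface_edist_ne_top (G : MetricRibbonGraph X n) (ρ : G.Vertex → ℝ)
    (p q : G.GluedSurface ρ) :
    @edist _ (inferInstanceAs (EDist (G.surfaceGluing ρ).Space)) p q ≠ ⊤ := by
  let D := G.surfaceGluing ρ
  let e : X → D.Point := fun x => ⟨x, G.headCorner ρ x, G.headCorner_mem_piece ρ x⟩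
  let e' : X → D.Point := fun x => ⟨x, G.tailCorner ρ x, G.tailCorner_mem_piece ρ x⟩
  have hee : ∀ x, edist (e' x) (e x) < ⊤ := fun x =>
    (D.edist_le_of_piece _ _).trans_lt (edist_lt_top _ _)
  have hE : Equivalence fun x y => edist (e x) (e y) < ⊤ := by
    refine ⟨fun x => by simp, fun {x y} h => by rwa [edist_comm], fun {x y z} h h' => ?_⟩
    exact (edist_triangle _ (e y) _).trans_lt (ENNReal.add_lt_top.2 ⟨h, h'⟩)
  have h1 : ∀ x, edist (e x) (e (G.s₁ x)) < ⊤ := by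
    intro x
    refine (edist_triangle _ (e' x) _).trans_lt (ENNReal.add_lt_top.2 ⟨?_, ?_⟩)
    · rw [edist_comm]
      exact hee x
    · have hg : D.glue x (G.tailCorner ρ x) (G.s₁ x) (G.headCorner ρ (G.s₁ x)) :=
        Or.inl ⟨rfl, Hyp.left_mem_seg _ _, Hyp.right_mem_seg _ _, by rw [dist_self, dist_self]⟩
      rw [D.edist_eq_zero_of_glue (p := e' x) (q := e (G.s₁ x)) hg]
      exact ENNReal.zero_lt_top
  have h2 : ∀ x, edist (e x) (e (G.s₂ x)) < ⊤ := by
    intro x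
    refine (edist_triangle _ (e' (G.s₂ x)) _).trans_lt (ENNReal.add_lt_top.2 ⟨?_, hee _⟩)
    have hg : D.glue x (G.headCorner ρ x) (G.s₂ x) (G.tailCorner ρ (G.s₂ x)) :=
      Or.inr ⟨rfl, Hyp.right_mem_seg _ _, Hyp.right_mem_seg _ _, by rw [dist_self, dist_self]⟩
    rw [D.edist_eq_zero_of_glue (p := e x) (q := e' (G.s₂ x)) hg]
    exact ENNReal.zero_lt_top
  have key : ∀ x y, edist (e x) (e y) < ⊤ := by
    refine G.rel_of_connected hE (fun x => ?_) h1
    refine hE.symm (hE.trans (h2 (G.s₀ x)) ?_)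
    have hs : G.s₂ (G.s₀ x) = G.s₁ x := by simp [RibbonGraph.s₂]
    rw [hs]
    exact hE.symm (h1 x)
  have toe : ∀ p : D.Point, edist p (e p.idx) < ⊤ := fun p =>
    (D.edist_le_of_piece p.mem _).trans_lt (edist_lt_top _ _)
  obtain ⟨p, rfl⟩ := SeparationQuotient.surjective_mk p
  obtain ⟨q, rfl⟩ := SeparationQuotient.surjective_mk q
  refine ne_of_lt (b := ⊤) (?_ : edist p q < ⊤)
  refine (edist_triangle _ (e p.idx) _).trans_lt (ENNReal.add_lt_top.2 ⟨toe p, ?_⟩)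
  refine (edist_triangle _ (e q.idx) _).trans_lt (ENNReal.add_lt_top.2 ⟨key _ _, ?_⟩)
  rw [edist_comm]
  exact toe q

instance (G : MetricRibbonGraph X n) (ρ : G.Vertex → ℝ) : MetricSpace (G.GluedSurface ρ) :=
  @EMetricSpace.toMetricSpace _ (inferInstanceAs (EMetricSpace (G.surfaceGluing ρ).Space))
    (G.surface_edist_ne_top ρ)

instance [Finite X] (G : MetricRibbonGraph X n) (ρ : G.Vertex → ℝ) :
    CompactSpace (G.GluedSurface ρ) :=
  (G.surfaceGluing ρ).compactSpace fun _ => Hyp.isCompact_quad _ _ _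

instance [Nonempty X] (G : MetricRibbonGraph X n) (ρ : G.Vertex → ℝ) :
    Nonempty (G.GluedSurface ρ) :=
  ⟨SeparationQuotient.mk (⟨Classical.arbitrary X, _, G.headCorner_mem_piece ρ _⟩ :
    (G.surfaceGluing ρ).Point)⟩

/-- The rib lengths of the hyperbolic surface with spine `G`. -/
def ribLengths [Fintype X] (G : MetricRibbonGraph X n) : G.Vertex → ℝ :=
  Classical.epsilon fun ρ => G.IsRibLengths ρ

/-- The hyperbolic surface `S(G)` with spine `G`, glued from quadrilaterals (halves of the hexagons
cut out by the ribs) whose corners fit together smoothly at the vertices of the spine. -/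
abbrev Surface [Fintype X] (G : MetricRibbonGraph X n) : Type _ := G.GluedSurface G.ribLengths

end MetricRibbonGraph

end

noncomputable section

/-! ## The hyperboloid model -/

namespace Hyp

/-! Rib lengths. By the hyperbolic law of cosines the corner at the end of a rib `r`, over a base
`l` with opposite rib `r'`, has cotangent `cotAngle l r r'`. The corners on the two sides of an edge
are congruent, so the condition at a vertex says that a sum of terms `π/2 - arctan (cotAngle ..)`
equals `π`. Two monotonicity facts settle existence and uniqueness. First, a corner grows with the
opposite rib (`cotAngle_antitone`); this permits a discrete Perron argument, in which the family of
largest total length with all angle sums at least `2π` is a solution (`exists_isRibLengths`).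
Second, a corner shrinks when the Gudermannian `arctan (sinh ·)` of its own rib grows at least as
much as that of the other rib (`cotAngle_lt`); this yields a maximum principle and hence uniqueness
(`IsRibLengths.le`).

Convergence. At a vertex with the longest rib some corner is not too small, and this bounds all ribs
in terms of the number of oriented edges and the shortest edge, hence by one `R` for all `N ≥ 1`
(`exists_ribLengths_scale_le`). So the surface lies within a bounded distance of its spine, and each
spine edge is longer than its base by at most `2R`. Projection along the perpendiculars to the bases
is `1/N`-Lipschitz from the surface to the graph; the edgewise linear map from the graph to the
spine is `(N + 2R/m)`-Lipschitz, where `m` bounds the edge lengths from below; the two are inverse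
to each other up to `O(R)` measured in the surface. After rescaling by `1/N` the Gromov–Hausdorff
distance is `O(1/N)` (`ghDist_rescaled_le`). -/

theorem abs_eq_of_cosh_eq {a b : ℝ} (h : Real.cosh a = Real.cosh b) : |a| = |b| :=
  le_antisymm (Real.cosh_le_cosh.1 h.le) (Real.cosh_le_cosh.1 h.ge)

theorem eq_zero_of_cosh_eq_one {a : ℝ} (h : Real.cosh a = 1) : a = 0 := by
  simpa using abs_eq_of_cosh_eq (h.trans Real.cosh_zero.symm)

/-- The first space coordinate in the hyperboloid model. -/
def hypX (z : ℍ) : ℝ := z.re / z.im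

/-- The second space coordinate in the hyperboloid model. -/
def hypY (z : ℍ) : ℝ := (z.re ^ 2 + z.im ^ 2 - 1) / (2 * z.im)

/-- The time coordinate in the hyperboloid model. -/
def hypT (z : ℍ) : ℝ := (z.re ^ 2 + z.im ^ 2 + 1) / (2 * z.im)

theorem hypT_sq (z : ℍ) : hypT z ^ 2 = 1 + hypX z ^ 2 + hypY z ^ 2 := by
  have := z.im_pos
  unfold hypT hypX hypY
  field_simp
  ring

theorem hypT_pos (z : ℍ) : 0 < hypT z := by
  have := z.im_pos
  unfold hypT
  positivity

/-- In these coordinates `cosh` of the distance is the Minkowski form, so statements about geodesics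
become linear algebra. -/
theorem cosh_dist_eq (z w : ℍ) :
    Real.cosh (dist z w) = hypT z * hypT w - hypX z * hypX w - hypY z * hypY w := by
  have hz := z.im_pos
  have hw := w.im_pos
  have h : dist (z : ℂ) (w : ℂ) ^ 2 = (z.re - w.re) ^ 2 + (z.im - w.im) ^ 2 := by
    rw [Complex.dist_eq, ← Complex.normSq_eq_norm_sq, Complex.normSq_apply]
    simp
    ring
  rw [UpperHalfPlane.cosh_dist, h]
  unfold hypT hypX hypY
  field_simp
  ring

theorem eq_of_hyp {z w : ℍ} (hX : hypX z = hypX w) (hY : hypY z = hypY w) : z = w := by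
  have hT : hypT z = hypT w := by
    have := hypT_sq z
    rw [hX, hY, ← hypT_sq w] at this
    exact (sq_eq_sq₀ (hypT_pos z).le (hypT_pos w).le).1 this
  apply dist_eq_zero.1
  have h : Real.cosh (dist z w) = 1 := by
    rw [cosh_dist_eq, hX, hY, hT]
    linarith [hypT_sq w]
  exact eq_zero_of_cosh_eq_one h

theorem exists_hyp {a b c : ℝ} (h : c ^ 2 = 1 + a ^ 2 + b ^ 2) (hc : 0 < c) :
    ∃ z : ℍ, hypX z = a ∧ hypY z = b ∧ hypT z = c := by
  have hbc : 0 < c - b := by nlinarith [sq_nonneg a, sq_nonneg (c - b), sq_nonneg (c + b)]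
  -- The witness comes from `hypT z - hypY z = 1 / z.im` and `hypX z = z.re / z.im`.
  refine ⟨⟨⟨a / (c - b), 1 / (c - b)⟩, by positivity⟩, ?_, ?_, ?_⟩
  · simp only [hypX, UpperHalfPlane.re, UpperHalfPlane.im]
    field_simp
  · simp only [hypY, UpperHalfPlane.re, UpperHalfPlane.im]
    field_simp
    linarith
  · simp only [hypT, UpperHalfPlane.re, UpperHalfPlane.im]
    field_simp
    linarith

/-! ### Fermi coordinates and the projection to the base line -/

theorem hypX_fermi (t s : ℝ) : hypX (fermi t s) = Real.sinh s := by
  have h1 := Real.cosh_pos s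
  simp only [hypX, UpperHalfPlane.re, UpperHalfPlane.im, fermi]
  rw [Real.tanh_eq_sinh_div_cosh]
  field_simp

theorem fermi_sq (t s : ℝ) : (Real.exp t * Real.tanh s) ^ 2 + (Real.exp t / Real.cosh s) ^ 2 =
    Real.exp t ^ 2 := by
  have h1 := Real.cosh_pos s
  rw [Real.tanh_eq_sinh_div_cosh]
  field_simp
  linarith [Real.cosh_sq s]

theorem hypY_fermi (t s : ℝ) : hypY (fermi t s) = Real.cosh s * Real.sinh t := by
  have h1 := Real.cosh_pos s
  simp only [hypY, UpperHalfPlane.re, UpperHalfPlane.im, fermi]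
  rw [fermi_sq, Real.sinh_eq t, Real.exp_neg]
  field_simp

theorem hypT_fermi (t s : ℝ) : hypT (fermi t s) = Real.cosh s * Real.cosh t := by
  have h1 := Real.cosh_pos s
  simp only [hypT, UpperHalfPlane.re, UpperHalfPlane.im, fermi]
  rw [fermi_sq, Real.cosh_eq t, Real.exp_neg]
  field_simp

theorem norm_fermi (t s : ℝ) : ‖(fermi t s : ℂ)‖ = Real.exp t := by
  rw [← sq_eq_sq₀ (norm_nonneg _) (Real.exp_pos t).le, ← fermi_sq t s,
    ← Complex.normSq_eq_norm_sq, Complex.normSq_apply]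
  simp only [fermi]
  ring

/-- The position of the foot of the perpendicular from `z` to `i ℝ₊`. -/
def proj (z : ℍ) : ℝ := Real.log ‖(z : ℂ)‖

theorem proj_fermi (t s : ℝ) : proj (fermi t s) = t := by
  rw [proj, norm_fermi, Real.log_exp]

theorem foot_eq (z : ℍ) : foot z = fermi (proj z) 0 := by
  apply UpperHalfPlane.ext
  simp [foot, fermi, proj, Real.exp_log (norm_pos_iff.2 z.ne_zero)]

theorem exists_fermi (z : ℍ) : ∃ t s, z = fermi t s := by
  refine ⟨Real.arsinh (hypY z / √(1 + hypX z ^ 2)), Real.arsinh (hypX z), ?_⟩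
  apply eq_of_hyp
  · rw [hypX_fermi, Real.sinh_arsinh]
  · rw [hypY_fermi, Real.sinh_arsinh, Real.cosh_arsinh]
    have : 0 < √(1 + hypX z ^ 2) := Real.sqrt_pos.2 (by positivity)
    field_simp

theorem cosh_dist_fermi (t s t' s' : ℝ) : Real.cosh (dist (fermi t s) (fermi t' s')) =
    Real.cosh s * Real.cosh s' * Real.cosh (t - t') - Real.sinh s * Real.sinh s' := by
  simp only [cosh_dist_eq, hypX_fermi, hypY_fermi, hypT_fermi, Real.cosh_sub]
  ring

theorem le_dist_of_cosh_le {a : ℝ} {z w : ℍ} (h : Real.cosh a ≤ Real.cosh (dist z w)) :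
    |a| ≤ dist z w := by
  simpa using Real.cosh_le_cosh.1 h

theorem dist_eq_of_cosh_eq {a : ℝ} {z w : ℍ} (h : Real.cosh (dist z w) = Real.cosh a) :
    dist z w = |a| := by
  simpa using abs_eq_of_cosh_eq h

theorem dist_fermi_same (t s s' : ℝ) : dist (fermi t s) (fermi t s') = |s - s'| := by
  apply dist_eq_of_cosh_eq
  rw [cosh_dist_fermi, Real.cosh_sub s s']
  simp

theorem dist_fermi_zero (t t' : ℝ) : dist (fermi t 0) (fermi t' 0) = |t - t'| := by
  apply dist_eq_of_cosh_eq
  rw [cosh_dist_fermi]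
  simp

/-- The cosine of the distance formula reads `cosh (s - s') + cosh s * cosh s' * (cosh (t - t') -
1)`, and both `cosh (s - s')` and `cosh s * cosh s'` are at least `1`. Thus the projection to the
base line is a contraction. -/
theorem abs_sub_le_dist_fermi (t s t' s' : ℝ) : |t - t'| ≤ dist (fermi t s) (fermi t' s') := by
  apply le_dist_of_cosh_le
  rw [cosh_dist_fermi]
  have h1 := Real.cosh_sub s s'
  have h2 := Real.one_le_cosh (s - s')
  have h3 := Real.one_le_cosh (t - t')
  have h4 := one_le_mul_of_one_le_of_one_le (Real.one_le_cosh s) (Real.one_le_cosh s')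
  nlinarith

theorem abs_proj_sub_le (z w : ℍ) : |proj z - proj w| ≤ dist z w := by
  obtain ⟨t, s, rfl⟩ := exists_fermi z
  obtain ⟨t', s', rfl⟩ := exists_fermi w
  rw [proj_fermi, proj_fermi]
  exact abs_sub_le_dist_fermi ..

theorem abs_sub_le_dist_fermi' (t s t' s' : ℝ) : |s - s'| ≤ dist (fermi t s) (fermi t' s') := by
  apply le_dist_of_cosh_le
  rw [cosh_dist_fermi, Real.cosh_sub]
  have h3 := Real.one_le_cosh (t - t')
  have h4 := mul_pos (Real.cosh_pos s) (Real.cosh_pos s')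
  nlinarith

/-- The coordinate `s` is 1-Lipschitz, so a point of the perpendicular segment must realise equality
in both bounds; the distance formula then forces `cosh (t - t') = 1`. -/
theorem proj_eq_of_mem_seg {t s : ℝ} {z : ℍ} (h : z ∈ seg (fermi t 0) (fermi t s)) :
    proj z = t := by
  obtain ⟨t', s', rfl⟩ := exists_fermi z
  rw [proj_fermi]
  have h : dist (fermi t 0) (fermi t' s') + dist (fermi t' s') (fermi t s) =
    dist (fermi t 0) (fermi t s) := h
  rw [dist_fermi_same] at h
  have h1 := abs_sub_le_dist_fermi' t 0 t' s'
  have h2 := abs_sub_le_dist_fermi' t' s' t s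
  have h3 := abs_sub_le 0 s' s
  have h4 : dist (fermi t 0) (fermi t' s') = |0 - s'| := by linarith
  have h5 := cosh_dist_fermi t 0 t' s'
  rw [h4, Real.cosh_abs] at h5
  simp only [zero_sub, Real.cosh_neg, Real.cosh_zero, Real.sinh_zero] at h5
  have h6 : Real.cosh (t - t') = 1 := by
    have := Real.cosh_pos s'
    apply mul_left_cancel₀ this.ne'
    linarith
  linarith [eq_zero_of_cosh_eq_one h6]

/-! ## Geodesics -/

/-- In Minkowski space an isotropic vector orthogonal to a timelike one vanishes. -/
theorem eq_zero_of_isotropic {a b c u v w : ℝ} (h : c ^ 2 = 1 + a ^ 2 + b ^ 2)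
    (h1 : w * c = u * a + v * b) (h2 : w ^ 2 = u ^ 2 + v ^ 2) : u = 0 ∧ v = 0 := by
  have h3 : w ^ 2 = - (u * b - v * a) ^ 2 := by
    have : w ^ 2 * c ^ 2 = (u * a + v * b) ^ 2 := by rw [← h1]; ring
    rw [h] at this
    linear_combination this - (a ^ 2 + b ^ 2) * h2
  have h4 : u ^ 2 + v ^ 2 ≤ 0 := by rw [← h2, h3]; nlinarith [sq_nonneg (u * b - v * a)]
  constructor <;> nlinarith [sq_nonneg u, sq_nonneg v]

/-- A point of a geodesic segment, as a linear combination of the end points. -/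
theorem hyp_of_mem_seg {A B z : ℍ} (h : z ∈ seg A B) :
    Real.sinh (dist A B) * hypX z =
      Real.sinh (dist z B) * hypX A + Real.sinh (dist A z) * hypX B ∧
    Real.sinh (dist A B) * hypY z =
      Real.sinh (dist z B) * hypY A + Real.sinh (dist A z) * hypY B := by
  have h : dist A z + dist z B = dist A B := h
  have hA := cosh_dist_eq A z
  have hB := cosh_dist_eq z B
  have hAB := cosh_dist_eq A B
  set p := dist A z
  set q := dist z B
  set d := dist A B
  have e1 : Real.sinh q = Real.sinh d * Real.cosh p - Real.cosh d * Real.sinh p := by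
    rw [← Real.sinh_sub, ← h]; congr 1; ring
  have e2 : Real.sinh p = Real.sinh d * Real.cosh q - Real.cosh d * Real.sinh q := by
    rw [← Real.sinh_sub, ← h]; congr 1; ring
  have e3 : Real.sinh d = Real.sinh p * Real.cosh q + Real.cosh p * Real.sinh q := by
    rw [← Real.sinh_add, h]
  have sA := hypT_sq A
  have sB := hypT_sq B
  have sz := hypT_sq z
  -- `(U, V, W)` is the defect of the desired linear relation. It is orthogonal to `A`, `B` and `z`,
  -- hence, as their linear combination, to itself.
  set U := Real.sinh d * hypX z - Real.sinh q * hypX A - Real.sinh p * hypX B with hU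
  set V := Real.sinh d * hypY z - Real.sinh q * hypY A - Real.sinh p * hypY B with hV
  set W := Real.sinh d * hypT z - Real.sinh q * hypT A - Real.sinh p * hypT B with hW
  have oA : W * hypT A = U * hypX A + V * hypY A := by
    linear_combination -Real.sinh d * hA + Real.sinh p * hAB - Real.sinh q * sA - e1
  have oB : W * hypT B = U * hypX B + V * hypY B := by
    linear_combination -Real.sinh d * hB + Real.sinh q * hAB - Real.sinh p * sB - e2
  have oz : W * hypT z = U * hypX z + V * hypY z := by
    linear_combination Real.sinh d * sz + Real.sinh q * hA + Real.sinh p * hB + e3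
  have oo : W ^ 2 = U ^ 2 + V ^ 2 := by
    linear_combination Real.sinh d * oz - Real.sinh q * oA - Real.sinh p * oB
  obtain ⟨hu, hv⟩ := eq_zero_of_isotropic sA oA oo
  constructor <;> linarith

theorem eq_of_mem_seg {A B z w : ℍ} (hz : z ∈ seg A B) (hw : w ∈ seg A B)
    (h : dist A z = dist A w) : z = w := by
  have hz' : dist A z + dist z B = dist A B := hz
  have hw' : dist A w + dist w B = dist A B := hw
  rcases eq_or_ne A B with rfl | hne
  · have h1 : dist A z = 0 := by
      rw [dist_self] at hz'
      linarith [dist_nonneg (x := A) (y := z), dist_nonneg (x := z) (y := A)]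
    have h2 : dist A w = 0 := h ▸ h1
    exact (dist_eq_zero.1 h1).symm.trans (dist_eq_zero.1 h2)
  · obtain ⟨x1, y1⟩ := hyp_of_mem_seg hz
    obtain ⟨x2, y2⟩ := hyp_of_mem_seg hw
    have hq : dist z B = dist w B := by linarith
    rw [h, hq, ← x2] at x1
    rw [h, hq, ← y2] at y1
    have hd : Real.sinh (dist A B) ≠ 0 := (Real.sinh_pos_iff.2 (dist_pos.2 hne)).ne'
    exact eq_of_hyp (mul_left_cancel₀ hd x1) (mul_left_cancel₀ hd y1)

/-- Any two points lie on a geodesic line. -/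
theorem exists_geodesic (A B : ℍ) : ∃ γ : ℝ → ℍ, γ 0 = A ∧ γ (dist A B) = B ∧
    ∀ s t, dist (γ s) (γ t) ≤ |s - t| := by
  rcases eq_or_ne A B with rfl | hne
  · exact ⟨fun _ => A, rfl, rfl, fun s t => by simp⟩
  have hd : 0 < Real.sinh (dist A B) := Real.sinh_pos_iff.2 (dist_pos.2 hne)
  have hAB := cosh_dist_eq A B
  have sA := hypT_sq A
  have sB := hypT_sq B
  have hc := Real.cosh_sq (dist A B)
  have hcp := Real.one_le_cosh (dist A B)
  set d := dist A B with hdd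
  -- `(u, v, w)` is the unit tangent vector at `A` pointing to `B`: orthogonal to `A` by `o1`, of
  -- norm one by `o2`. The geodesic is `cosh p • A + sinh p • (u, v, w)`.
  set u := (hypX B - Real.cosh d * hypX A) / Real.sinh d with hu
  set v := (hypY B - Real.cosh d * hypY A) / Real.sinh d with hv
  set w := (hypT B - Real.cosh d * hypT A) / Real.sinh d with hw
  have hu' : Real.sinh d * u = hypX B - Real.cosh d * hypX A := by rw [hu]; field_simp
  have hv' : Real.sinh d * v = hypY B - Real.cosh d * hypY A := by rw [hv]; field_simp
  have hw' : Real.sinh d * w = hypT B - Real.cosh d * hypT A := by rw [hw]; field_simp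
  have o1 : w * hypT A = u * hypX A + v * hypY A := by
    apply mul_left_cancel₀ hd.ne'
    linear_combination hypT A * hw' - hypX A * hu' - hypY A * hv' - hAB - Real.cosh d * sA
  have o2 : w ^ 2 = u ^ 2 + v ^ 2 - 1 := by
    have : Real.sinh d ^ 2 * (w ^ 2 - u ^ 2 - v ^ 2 + 1) = 0 := by
      have e : (Real.sinh d * w) ^ 2 - (Real.sinh d * u) ^ 2 - (Real.sinh d * v) ^ 2
          + Real.sinh d ^ 2 = 0 := by
        rw [hu', hv', hw']
        linear_combination sB + Real.cosh d ^ 2 * sA + 2 * Real.cosh d * hAB - hc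
      linear_combination e
    rcases mul_eq_zero.1 this with h | h
    · exact absurd h (by positivity)
    · linarith
  -- The curve stays on the upper sheet: Cauchy–Schwarz and `o1` give `|w| < hypT A`, and `|sinh p|
  -- < cosh p`.
  have hT : ∀ p, 0 < Real.cosh p * hypT A + Real.sinh p * w := by
    intro p
    have h1 : w ^ 2 < hypT A ^ 2 := by
      have key : (u * hypX A + v * hypY A) ^ 2 ≤ (u ^ 2 + v ^ 2) * (hypX A ^ 2 + hypY A ^ 2) := by
        nlinarith [sq_nonneg (u * hypY A - v * hypX A)]
      rw [← o1] at key
      nlinarith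
    have h2 : |w| < hypT A := abs_lt_of_sq_lt_sq h1 (hypT_pos A).le
    have h3 : |Real.sinh p| < Real.cosh p :=
      abs_lt_of_sq_lt_sq (by linarith [Real.cosh_sq p]) (Real.cosh_pos p).le
    have h4 : |Real.sinh p * w| < Real.cosh p * hypT A := by
      rw [abs_mul]
      exact mul_lt_mul'' h3 h2 (abs_nonneg _) (abs_nonneg _)
    linarith [neg_abs_le (Real.sinh p * w)]
  have hex : ∀ p, ∃ z : ℍ, hypX z = Real.cosh p * hypX A + Real.sinh p * u ∧
      hypY z = Real.cosh p * hypY A + Real.sinh p * v ∧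
      hypT z = Real.cosh p * hypT A + Real.sinh p * w := by
    intro p
    apply exists_hyp _ (hT p)
    linear_combination Real.cosh p ^ 2 * sA + Real.sinh p ^ 2 * o2 +
      2 * Real.cosh p * Real.sinh p * o1 + Real.cosh_sq p
  choose γ h1 h2 h3 using hex
  refine ⟨γ, ?_, ?_, fun s t => le_of_eq (dist_eq_of_cosh_eq ?_)⟩
  · apply eq_of_hyp
    · simp [h1]
    · simp [h2]
  · apply eq_of_hyp
    · rw [h1, hu']; ring
    · rw [h2, hv']; ring
  · rw [cosh_dist_eq, h1, h1, h2, h2, h3, h3, Real.cosh_sub]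
    linear_combination Real.cosh s * Real.cosh t * sA + Real.sinh s * Real.sinh t * o2 +
      (Real.cosh s * Real.sinh t + Real.cosh t * Real.sinh s) * o1

end Hyp

/-! ## Angles of quadrilaterals -/

namespace Hyp

theorem sinh_dist_eq (z a : ℍ) : Real.sinh (dist z a) =
    ‖(a : ℂ) - z‖ * ‖(a : ℂ) - starRingEnd ℂ (z : ℂ)‖ / (2 * a.im * z.im) := by
  have h : Real.sinh (dist z a) = 2 * Real.sinh (dist a z / 2) * Real.cosh (dist a z / 2) := by
    rw [← Real.sinh_two_mul, dist_comm]
    congr 1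
    ring
  rw [h, UpperHalfPlane.sinh_half_dist, UpperHalfPlane.cosh_half_dist, Complex.dist_eq,
    Complex.dist_eq]
  have h1 := mul_pos a.im_pos z.im_pos
  have h2 := Real.mul_self_sqrt h1.le
  have h3 := Real.sqrt_pos.2 h1
  have h4 : 2 * a.im * z.im = 2 * (√(a.im * z.im) * √(a.im * z.im)) := by rw [h2]; ring
  rw [h4]
  field_simp

theorem cosh_dist_eq' (z a : ℍ) : Real.cosh (dist z a) =
    1 + ((z.re - a.re) ^ 2 + (z.im - a.im) ^ 2) / (2 * z.im * a.im) := by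
  rw [UpperHalfPlane.cosh_dist, Complex.dist_eq, ← Complex.normSq_eq_norm_sq,
    Complex.normSq_apply]
  simp
  ring

/-- The hyperbolic law of cosines. -/
theorem cos_angle_mul {a z b : ℍ} (ha : a ≠ z) (hb : b ≠ z) :
    Real.cos (angle a z b) * (Real.sinh (dist z a) * Real.sinh (dist z b)) =
      Real.cosh (dist z a) * Real.cosh (dist z b) - Real.cosh (dist a b) := by
  have hap := a.im_pos
  have hbp := b.im_pos
  have hzp := z.im_pos
  have hp : ‖(a : ℂ) - z‖ ≠ 0 := norm_ne_zero_iff.2 (sub_ne_zero.2 fun h => ha (UpperHalfPlane.ext h))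
  have hq : ‖(b : ℂ) - z‖ ≠ 0 := norm_ne_zero_iff.2 (sub_ne_zero.2 fun h => hb (UpperHalfPlane.ext h))
  have hA : ‖(a : ℂ) - starRingEnd ℂ (z : ℂ)‖ ≠ 0 := by
    refine norm_ne_zero_iff.2 fun h => ?_
    have := congrArg Complex.im h
    simp at this
    linarith
  have hB : ‖(b : ℂ) - starRingEnd ℂ (z : ℂ)‖ ≠ 0 := by
    refine norm_ne_zero_iff.2 fun h => ?_
    have := congrArg Complex.im h
    simp at this
    linarith
  have nA : ‖(a : ℂ) - starRingEnd ℂ (z : ℂ)‖ ^ 2 = (a.re - z.re) ^ 2 + (a.im + z.im) ^ 2 := by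
    rw [← Complex.normSq_eq_norm_sq, Complex.normSq_apply]
    simp
    ring
  have nB : ‖(b : ℂ) - starRingEnd ℂ (z : ℂ)‖ ^ 2 = (b.re - z.re) ^ 2 + (b.im + z.im) ^ 2 := by
    rw [← Complex.normSq_eq_norm_sq, Complex.normSq_apply]
    simp
    ring
  have pA : 0 < (a.re - z.re) ^ 2 + (a.im + z.im) ^ 2 := by positivity
  have pB : 0 < (b.re - z.re) ^ 2 + (b.im + z.im) ^ 2 := by positivity
  have key : Real.cos (angle a z b) * (Real.sinh (dist z a) * Real.sinh (dist z b)) =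
      inner ℝ (diskCoord z a) (diskCoord z b) *
        (‖(a : ℂ) - starRingEnd ℂ (z : ℂ)‖ ^ 2 * ‖(b : ℂ) - starRingEnd ℂ (z : ℂ)‖ ^ 2) /
        (4 * a.im * b.im * z.im ^ 2) := by
    rw [angle, InnerProductGeometry.cos_angle, sinh_dist_eq, sinh_dist_eq]
    have e : ∀ c : ℍ, ‖diskCoord z c‖ = ‖(c : ℂ) - z‖ / ‖(c : ℂ) - starRingEnd ℂ (z : ℂ)‖ :=
      fun c => norm_div _ _
    rw [e, e]
    field_simp
    ring
  have hn : ∀ c : ℍ, Complex.normSq ((c : ℂ) - starRingEnd ℂ (z : ℂ)) =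
      (c.re - z.re) ^ 2 + (c.im + z.im) ^ 2 := by
    intro c
    rw [Complex.normSq_apply]
    simp
    ring
  have hin : inner ℝ (diskCoord z a) (diskCoord z b) =
      (diskCoord z a).re * (diskCoord z b).re + (diskCoord z a).im * (diskCoord z b).im := by
    rw [Complex.inner]
    simp
    ring
  rw [key, nA, nB, hin, cosh_dist_eq', cosh_dist_eq', cosh_dist_eq']
  simp only [diskCoord, Complex.div_re, Complex.div_im, hn, Complex.sub_re, Complex.sub_im,
    Complex.conj_re, Complex.conj_im, UpperHalfPlane.coe_re, UpperHalfPlane.coe_im]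
  field_simp
  ring

/-- The cotangent of the angle of a quadrilateral at the end of the rib of length `r`. -/
def cotAngle (l r r' : ℝ) : ℝ :=
  (Real.sinh r * Real.cosh l - Real.cosh r * Real.tanh r') / Real.sinh l

/-- With `d` the distance between the two corners, the law of cosines gives the cosine `p / sinh d`,
and `p ^ 2 + q ^ 2 = sinh d ^ 2` with `q > 0`, so the cotangent is `p / q`. Writing the angle with
`arctan` keeps it in `(0, π)` whatever the sign of `p`. The hypothesis `|t - t'| = l` covers the
tail and the head corner at once. -/
theorem angle_fermi {t t' r l : ℝ} (r' : ℝ) (hl : 0 < l) (ht : |t - t'| = l) (hr : 0 < r) :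
    angle (fermi t 0) (fermi t r) (fermi t' r') = Real.pi / 2 - Real.arctan (cotAngle l r r') := by
  have hC : Real.cosh (t - t') = Real.cosh l := by rw [← ht, Real.cosh_abs]
  have hsl : 0 < Real.sinh l := Real.sinh_pos_iff.2 hl
  have hcl := Real.one_le_cosh l
  have hsr : 0 < Real.sinh r := Real.sinh_pos_iff.2 hr
  have h1 : dist (fermi t r) (fermi t 0) = r := by rw [dist_fermi_same, sub_zero, abs_of_pos hr]
  have h2 : 0 < dist (fermi t r) (fermi t' r') :=
    lt_of_lt_of_le (ht ▸ hl) (abs_sub_le_dist_fermi ..)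
  have ha : fermi t 0 ≠ fermi t r := by
    rw [← dist_pos, dist_comm, h1]; exact hr
  have hb : fermi t' r' ≠ fermi t r := by
    rw [← dist_pos, dist_comm]; exact h2
  have hcos := cos_angle_mul ha hb
  rw [h1, cosh_dist_fermi, cosh_dist_fermi, hC] at hcos
  have hD := cosh_dist_fermi t r t' r'
  rw [hC] at hD
  set d := dist (fermi t r) (fermi t' r')
  have hsd : 0 < Real.sinh d := Real.sinh_pos_iff.2 h2
  have hsq := Real.cosh_sq d
  set p := Real.sinh r * Real.cosh r' * Real.cosh l - Real.cosh r * Real.sinh r' with hp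
  set q := Real.cosh r' * Real.sinh l with hq
  have hcr' := Real.cosh_pos r'
  have hqp : 0 < q := by positivity
  have hpq : p ^ 2 + q ^ 2 = Real.sinh d ^ 2 := by
    have hr2 := Real.cosh_sq r
    have hr2' := Real.cosh_sq r'
    have hl2 := Real.cosh_sq l
    have : p ^ 2 + q ^ 2 = (Real.cosh r * Real.cosh r' * Real.cosh l -
        Real.sinh r * Real.sinh r') ^ 2 - 1 := by
      rw [hp, hq]
      have e : Real.sinh l ^ 2 = Real.cosh l ^ 2 - 1 := by linarith
      rw [mul_pow _ (Real.sinh l), e]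
      linear_combination (-(Real.cosh r' * Real.cosh l) ^ 2 + Real.sinh r' ^ 2) * hr2 - hr2'
    rw [this, ← hD]
    linarith
  have hcot : cotAngle l r r' = p / q := by
    rw [cotAngle, hp, hq, Real.tanh_eq_sinh_div_cosh]
    field_simp
  have hsqrt : √(1 + (p / q) ^ 2) = Real.sinh d / q := by
    rw [Real.sqrt_eq_iff_mul_self_eq_of_pos (by positivity)]
    field_simp
    linarith
  have hcos' : Real.cos (angle (fermi t 0) (fermi t r) (fermi t' r')) =
      Real.cos (Real.pi / 2 - Real.arctan (cotAngle l r r')) := by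
    rw [Real.cos_pi_div_two_sub, Real.sin_arctan, hcot, hsqrt]
    have e : Real.cos (angle (fermi t 0) (fermi t r) (fermi t' r')) * Real.sinh d = p := by
      apply mul_left_cancel₀ hsr.ne'
      simp only [Real.cosh_zero, Real.sinh_zero] at hcos
      rw [hp]
      linear_combination hcos + Real.cosh r' * Real.cosh l * Real.cosh_sq r
    rw [← e]
    field_simp
  refine Real.injOn_cos ⟨InnerProductGeometry.angle_nonneg _ _, InnerProductGeometry.angle_le_pi _ _⟩
    ⟨?_, ?_⟩ hcos'
  · linarith [Real.arctan_lt_pi_div_two (cotAngle l r r')]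
  · linarith [Real.neg_pi_div_two_lt_arctan (cotAngle l r r')]

/-! ### The Gudermannian and the monotonicity of the angles -/

theorem sin_arctan_sinh (r : ℝ) : Real.sin (Real.arctan (Real.sinh r)) = Real.tanh r := by
  rw [Real.sin_arctan, Real.tanh_eq_sinh_div_cosh, ← Real.cosh_sq', Real.sqrt_sq (Real.cosh_pos r).le]

theorem cos_arctan_sinh (r : ℝ) : Real.cos (Real.arctan (Real.sinh r)) = 1 / Real.cosh r := by
  rw [Real.cos_arctan, ← Real.cosh_sq', Real.sqrt_sq (Real.cosh_pos r).le]

theorem one_lt_cosh_of_pos {l : ℝ} (hl : 0 < l) : 1 < Real.cosh l := Real.one_lt_cosh.2 hl.ne'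

theorem tanh_monotone : Monotone Real.tanh := by
  intro r s h
  rw [Real.tanh_eq_sinh_div_cosh, Real.tanh_eq_sinh_div_cosh,
    div_le_div_iff₀ (Real.cosh_pos _) (Real.cosh_pos _)]
  have := Real.sinh_nonneg_iff.2 (sub_nonneg.2 h)
  rw [Real.sinh_sub] at this
  linarith

theorem cotAngle_antitone {l : ℝ} (hl : 0 < l) (r : ℝ) {s t : ℝ} (h : s ≤ t) :
    cotAngle l r t ≤ cotAngle l r s := by
  have h1 := Real.sinh_pos_iff.2 hl
  have h2 := mul_le_mul_of_nonneg_left (tanh_monotone h) (Real.cosh_pos r).le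
  unfold cotAngle
  gcongr ?_ / _
  linarith

theorem cotAngle_self {l : ℝ} (hl : 0 < l) (r : ℝ) :
    cotAngle l r r = Real.sinh r * Real.tanh (l / 2) := by
  have h1 := Real.sinh_pos_iff.2 (half_pos hl)
  have h2 := Real.cosh_pos (l / 2)
  have h3 := Real.cosh_pos r
  have e1 : Real.sinh l = 2 * Real.sinh (l / 2) * Real.cosh (l / 2) := by
    rw [← Real.sinh_two_mul]; congr 1; ring
  have e2 : Real.cosh l = 1 + 2 * Real.sinh (l / 2) ^ 2 := by
    have : Real.cosh l = Real.cosh (2 * (l / 2)) := by congr 1; ring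
    rw [this, Real.cosh_two_mul, Real.cosh_sq]
    ring
  rw [cotAngle, Real.tanh_eq_sinh_div_cosh, Real.tanh_eq_sinh_div_cosh, e1, e2]
  field_simp
  ring

/-- This is `cotAngle_lt` in terms of Gudermannians. If `w + m ≤ π / 2`, the worst case is `t = w +
m`, where the left side equals `sin m * cos (w - u)`. Otherwise `sin t` is bounded by `1`, `cos u`
is expanded as `cos ((u + m) - m)`, and `cos m ≤ sin w`. -/
theorem sin_sub_le {u w m t : ℝ} (hu : 0 ≤ u) (hum : u + m ≤ Real.pi / 2)
    (hw : w ≤ Real.pi / 2) (hm : 0 ≤ m) (ht : 0 ≤ t) (ht' : t ≤ w + m) :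
    Real.sin t * Real.cos u - Real.sin w * Real.cos (u + m) ≤ Real.sin m := by
  have hpi := Real.pi_pos
  have hsm : 0 ≤ Real.sin m := Real.sin_nonneg_of_nonneg_of_le_pi hm (by linarith)
  have hcu : 0 ≤ Real.cos u := Real.cos_nonneg_of_mem_Icc ⟨by linarith, by linarith⟩
  rcases le_total (w + m) (Real.pi / 2) with h | h
  · have h1 : Real.sin t ≤ Real.sin (w + m) :=
      Real.sin_le_sin_of_le_of_le_pi_div_two (by linarith) h ht'
    have h2 : Real.sin (w + m) * Real.cos u - Real.sin w * Real.cos (u + m) =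
        Real.sin m * Real.cos (w - u) := by
      rw [Real.sin_add, Real.cos_add, Real.cos_sub]
      ring
    have h3 := mul_le_mul_of_nonneg_right h1 hcu
    have h4 := mul_le_mul_of_nonneg_left (Real.cos_le_one (w - u)) hsm
    linarith
  · have h1 : Real.cos m ≤ Real.sin w := by
      rw [← Real.cos_pi_div_two_sub]
      exact Real.cos_le_cos_of_nonneg_of_le_pi (by linarith) (by linarith) (by linarith)
    have h2 : Real.cos u = Real.cos (u + m) * Real.cos m + Real.sin (u + m) * Real.sin m := by
      rw [← Real.cos_sub]; congr 1; ring
    have h3 : 0 ≤ Real.cos (u + m) := Real.cos_nonneg_of_mem_Icc ⟨by linarith, by linarith⟩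
    have h4 := mul_le_mul_of_nonneg_right (Real.sin_le_one t) hcu
    have h5 := mul_le_mul_of_nonneg_right (Real.sin_le_one (u + m)) hsm
    have h6 := mul_le_mul_of_nonneg_left h1 h3
    linarith

/-- The angle at a rib decreases if the Gudermannian of the rib length increases at least as much
as that of the other rib. -/
theorem cotAngle_lt {l r₁ r₂ s₁ s₂ : ℝ} (hl : 0 < l) (hr₁ : 0 < r₁) (hs₂ : 0 < s₂)
    (hr : Real.arctan (Real.sinh r₁) < Real.arctan (Real.sinh r₂))
    (h : Real.arctan (Real.sinh s₂) - Real.arctan (Real.sinh s₁) ≤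
      Real.arctan (Real.sinh r₂) - Real.arctan (Real.sinh r₁)) :
    cotAngle l r₁ s₁ < cotAngle l r₂ s₂ := by
  have pos : ∀ {r : ℝ}, 0 < r → 0 ≤ Real.arctan (Real.sinh r) := fun hr =>
    Real.arctan_nonneg.2 (Real.sinh_pos_iff.2 hr).le
  have lt : ∀ r : ℝ, Real.arctan (Real.sinh r) ≤ Real.pi / 2 := fun r =>
    (Real.arctan_lt_pi_div_two _).le
  set m := Real.arctan (Real.sinh r₂) - Real.arctan (Real.sinh r₁) with hm
  have e : Real.arctan (Real.sinh r₁) + m = Real.arctan (Real.sinh r₂) := by rw [hm]; ring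
  have key := sin_sub_le (u := Real.arctan (Real.sinh r₁)) (w := Real.arctan (Real.sinh s₁))
    (m := m) (t := Real.arctan (Real.sinh s₂)) (pos hr₁) (by rw [e]; exact lt _) (lt _)
    (by linarith) (pos hs₂) (by linarith)
  rw [e, hm, Real.sin_sub, sin_arctan_sinh, sin_arctan_sinh, sin_arctan_sinh, sin_arctan_sinh,
    cos_arctan_sinh, cos_arctan_sinh, Real.tanh_eq_sinh_div_cosh r₁,
    Real.tanh_eq_sinh_div_cosh r₂] at key
  have c1 := Real.cosh_pos r₁
  have c2 := Real.cosh_pos r₂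
  -- The numerator of `cotAngle l r s` is `sinh r * (cosh l - 1)` plus the quantity compared here;
  -- the first summand increases strictly with `r`.
  have key' : Real.sinh r₁ - Real.cosh r₁ * Real.tanh s₁ ≤
      Real.sinh r₂ - Real.cosh r₂ * Real.tanh s₂ := by
    have := mul_le_mul_of_nonneg_right key (mul_pos c1 c2).le
    field_simp at this
    linarith
  have hlt : Real.sinh r₁ < Real.sinh r₂ := Real.arctan_strictMono.lt_iff_lt.1 hr
  have hc := one_lt_cosh_of_pos hl
  have h1 := Real.sinh_pos_iff.2 hl
  unfold cotAngle
  gcongr ?_ / _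
  nlinarith

/-! ### The side of a quadrilateral opposite to the base -/

theorem dist_corners_comm (l r r' : ℝ) :
    dist (fermi 0 r) (fermi l r') = dist (fermi 0 r') (fermi l r) := by
  rw [← abs_of_nonneg (dist_nonneg (x := fermi 0 r') (y := fermi l r))]
  apply dist_eq_of_cosh_eq
  rw [cosh_dist_fermi, cosh_dist_fermi]
  ring

/-- The map `t ↦ l - t` is the reflection in the perpendicular bisector of the base; it exchanges
the two ribs. -/
theorem dist_reflect (l t s t' s' : ℝ) :
    dist (fermi (l - t) s) (fermi (l - t') s') = dist (fermi t s) (fermi t' s') := by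
  rw [← abs_of_nonneg (dist_nonneg (x := fermi t s) (y := fermi t' s'))]
  apply dist_eq_of_cosh_eq
  rw [cosh_dist_fermi, cosh_dist_fermi, ← Real.cosh_neg (t - t')]
  ring_nf

/-- Points of the sides opposite to the base of a quadrilateral and of its mirror image which
correspond to each other have corresponding projections to the base. -/
theorem proj_add_proj {l r r' : ℝ} {a b : ℍ} (ha : a ∈ seg (fermi 0 r) (fermi l r'))
    (hb : b ∈ seg (fermi 0 r') (fermi l r)) (h : dist a (fermi 0 r) = dist b (fermi l r)) :
    proj a + proj b = l := by
  obtain ⟨t, s, rfl⟩ := exists_fermi b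
  have r1 := dist_reflect l t s 0 r'
  have r2 := dist_reflect l t s l r
  have r3 := dist_reflect l 0 r' l r
  rw [sub_zero] at r1 r3
  rw [sub_self] at r2 r3
  have hb : dist (fermi 0 r') (fermi t s) + dist (fermi t s) (fermi l r) =
    dist (fermi 0 r') (fermi l r) := hb
  -- The mirror image of `b` lies on the segment of `a`, at the same distance from `fermi 0 r`, and
  -- so coincides with `a`.
  have hb' : fermi (l - t) s ∈ seg (fermi 0 r) (fermi l r') := by
    change dist (fermi 0 r) (fermi (l - t) s) + dist (fermi (l - t) s) (fermi l r') =
      dist (fermi 0 r) (fermi l r')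
    rw [dist_comm (fermi 0 r), dist_comm (fermi 0 r), r1, r2, r3, ← hb, add_comm,
      dist_comm (fermi t s) (fermi 0 r')]
  rw [eq_of_mem_seg ha hb' (by rw [dist_comm, h, ← r2, dist_comm]), proj_fermi, proj_fermi]
  ring

theorem dist_corners_le {l r r' : ℝ} (hl : 0 < l) (hr : 0 ≤ r) (hr' : 0 ≤ r') :
    dist (fermi 0 r) (fermi l r') ≤ r + l + r' := by
  have h1 := dist_triangle (fermi 0 r) (fermi 0 0) (fermi l r')
  have h2 := dist_triangle (fermi 0 0) (fermi l 0) (fermi l r')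
  rw [dist_fermi_same, sub_zero, abs_of_nonneg hr] at h1
  rw [dist_fermi_same, dist_fermi_zero, zero_sub, zero_sub, abs_neg, abs_neg, abs_of_nonneg hr',
    abs_of_pos hl] at h2
  linarith

theorem le_dist_corners (l r r' : ℝ) : l ≤ dist (fermi 0 r) (fermi l r') := by
  have := abs_sub_le_dist_fermi 0 r l r'
  rw [zero_sub, abs_neg] at this
  exact (le_abs_self l).trans this

/-- By `hyp_of_mem_seg` the coordinates `sinh s` and `cosh s * sinh t` are combinations of those of
the corners with nonnegative weights, of sum at most `1` because `sinh` is superadditive. The bound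
`t ≤ l` is left to a reflection. -/
theorem spine_bounds {l r r' R : ℝ} (hl : 0 < l) (hr : 0 ≤ r) (hr' : 0 ≤ r') (hrR : r ≤ R)
    (hrR' : r' ≤ R) {t s : ℝ} (h : fermi t s ∈ seg (fermi 0 r) (fermi l r')) :
    0 ≤ t ∧ 0 ≤ s ∧ s ≤ R := by
  have hd : 0 < Real.sinh (dist (fermi 0 r) (fermi l r')) :=
    Real.sinh_pos_iff.2 (hl.trans_le (le_dist_corners ..))
  obtain ⟨h1, h2⟩ := hyp_of_mem_seg h
  simp only [hypX_fermi, hypY_fermi, Real.sinh_zero, mul_zero] at h1 h2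
  have hseg : dist (fermi 0 r) (fermi t s) + dist (fermi t s) (fermi l r') =
    dist (fermi 0 r) (fermi l r') := h
  set p := dist (fermi 0 r) (fermi t s) with hp
  set q := dist (fermi t s) (fermi l r') with hq
  have hp0 : 0 ≤ Real.sinh p := Real.sinh_nonneg_iff.2 dist_nonneg
  have hq0 : 0 ≤ Real.sinh q := Real.sinh_nonneg_iff.2 dist_nonneg
  have hs0 : 0 ≤ Real.sinh r := Real.sinh_nonneg_iff.2 hr
  have hs0' : 0 ≤ Real.sinh r' := Real.sinh_nonneg_iff.2 hr'
  have hs1 : Real.sinh r ≤ Real.sinh R := Real.sinh_le_sinh.2 hrR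
  have hs1' : Real.sinh r' ≤ Real.sinh R := Real.sinh_le_sinh.2 hrR'
  have hl0 : 0 ≤ Real.sinh l := Real.sinh_nonneg_iff.2 hl.le
  have hpq : Real.sinh p + Real.sinh q ≤ Real.sinh (dist (fermi 0 r) (fermi l r')) := by
    rw [← hseg, Real.sinh_add]
    nlinarith [Real.one_le_cosh p, Real.one_le_cosh q]
  refine ⟨?_, ?_, ?_⟩
  · have h3 : 0 ≤ Real.cosh s * Real.sinh t := by
      refine (mul_nonneg_iff_of_pos_left hd).1 ?_
      rw [h2]
      have := Real.cosh_pos r'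
      positivity
    exact Real.sinh_nonneg_iff.1 ((mul_nonneg_iff_of_pos_left (Real.cosh_pos s)).1 h3)
  · refine Real.sinh_nonneg_iff.1 ((mul_nonneg_iff_of_pos_left hd).1 ?_)
    rw [h1]
    positivity
  · refine Real.sinh_le_sinh.1 (le_of_mul_le_mul_left ?_ hd)
    rw [h1]
    nlinarith

/-- The upper bound on `proj y` is the lower bound for the mirror image. For the last estimate, the
distance along the side is at least `proj y` since projection contracts, and at most the length `r +
proj y + s` of the detour through the base. -/
theorem spine_bounds' {l r r' R : ℝ} (hl : 0 < l) (hr : 0 ≤ r) (hr' : 0 ≤ r') (hrR : r ≤ R)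
    (hrR' : r' ≤ R) {y : ℍ} (h : y ∈ seg (fermi 0 r) (fermi l r')) :
    0 ≤ proj y ∧ proj y ≤ l ∧ dist y (foot y) ≤ R ∧ |dist (fermi 0 r) y - proj y| ≤ 2 * R := by
  obtain ⟨t, s, rfl⟩ := exists_fermi y
  have hb := spine_bounds hl hr hr' hrR hrR' h
  have h' : fermi (l - t) s ∈ seg (fermi 0 r') (fermi l r) := by
    have r1 := dist_reflect l t s 0 r
    have r2 := dist_reflect l t s l r'
    have r3 := dist_reflect l 0 r l r'
    rw [sub_zero] at r1 r3
    rw [sub_self] at r2 r3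
    have h : dist (fermi 0 r) (fermi t s) + dist (fermi t s) (fermi l r') =
      dist (fermi 0 r) (fermi l r') := h
    change dist (fermi 0 r') (fermi (l - t) s) + dist (fermi (l - t) s) (fermi l r) =
      dist (fermi 0 r') (fermi l r)
    rw [dist_comm (fermi 0 r'), dist_comm (fermi 0 r'), r1, r2, r3, ← h, add_comm,
      dist_comm (fermi t s) (fermi 0 r)]
  have hb' := spine_bounds hl hr' hr hrR' hrR h'
  have e1 : dist (fermi t s) (fermi t 0) = s := by
    rw [dist_fermi_same, sub_zero, abs_of_nonneg hb.2.1]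
  rw [foot_eq, proj_fermi, e1]
  refine ⟨hb.1, by linarith [hb'.1], hb.2.2, ?_⟩
  have h1 := abs_sub_le_dist_fermi 0 r t s
  rw [zero_sub, abs_neg, abs_of_nonneg hb.1] at h1
  have h2 := dist_triangle (fermi 0 r) (fermi 0 0) (fermi t s)
  have h3 := dist_triangle (fermi 0 0) (fermi t 0) (fermi t s)
  rw [dist_fermi_same, sub_zero, abs_of_nonneg hr] at h2
  rw [dist_fermi_zero, zero_sub, abs_neg, abs_of_nonneg hb.1, dist_comm (fermi t 0), e1] at h3
  rw [abs_le]
  constructor <;> linarith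

/-- Every point of a quadrilateral is close to the side opposite to the base. -/
theorem exists_spine_of_mem_quad {l r r' R : ℝ} (hl : 0 < l) (hr : 0 ≤ r) (hr' : 0 ≤ r')
    (hrR : r ≤ R) (hrR' : r' ≤ R) {z : ℍ} (h : z ∈ quad l r r') :
    ∃ y ∈ seg (fermi 0 r) (fermi l r'), proj z = proj y ∧ dist z y ≤ R := by
  obtain ⟨y, hy, hz⟩ := h
  have hb := (spine_bounds' hl hr hr' hrR hrR' hy).2.2.1
  refine ⟨y, hy, ?_, ?_⟩
  · obtain ⟨t, s, rfl⟩ := exists_fermi y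
    rw [foot_eq, proj_fermi] at hz
    rw [proj_eq_of_mem_seg hz, proj_fermi]
  · have : dist (foot y) z + dist z y = dist (foot y) y := hz
    rw [dist_comm y] at hb
    linarith [dist_nonneg (x := foot y) (y := z)]

end Hyp

/-! ## Existence and uniqueness of rib lengths -/

namespace Hyp

theorem continuous_cotAngle (l : ℝ) : Continuous fun p : ℝ × ℝ => cotAngle l p.1 p.2 := by
  have h : Continuous Real.tanh := by
    have : Real.tanh = fun x => Real.sinh x / Real.cosh x :=
      funext Real.tanh_eq_sinh_div_cosh
    rw [this]
    exact Real.continuous_sinh.div Real.continuous_cosh fun x => (Real.cosh_pos x).ne'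
  exact ((by fun_prop : Continuous fun p : ℝ × ℝ =>
    Real.sinh p.1 * Real.cosh l - Real.cosh p.1 * Real.tanh p.2)).div_const _

theorem tanh_pos_of_pos {x : ℝ} (hx : 0 < x) : 0 < Real.tanh x := by
  rw [Real.tanh_eq_sinh_div_cosh]
  exact div_pos (Real.sinh_pos_iff.2 hx) (Real.cosh_pos x)

end Hyp

namespace RibbonGraph

variable {X : Type*} {n : ℕ}

instance [Finite X] (G : RibbonGraph X n) : Finite G.Vertex :=
  inferInstanceAs (Finite (Quotient _))

theorem exists_head_eq (G : RibbonGraph X n) (v : G.Vertex) : ∃ x, G.head x = v :=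
  Quotient.exists_rep v

theorem one_lt_card [Fintype X] [Nonempty X] (G : RibbonGraph X n) : 1 < Fintype.card X :=
  Fintype.one_lt_card_iff.2 ⟨_, _, G.s₀_ne (Classical.arbitrary X)⟩

end RibbonGraph

namespace MetricRibbonGraph

variable {X : Type*} {n : ℕ}

theorem headAngle_eq (G : MetricRibbonGraph X n) {ρ : G.Vertex → ℝ} (hρ : ∀ v, 0 < ρ v) (x : X) :
    G.headAngle ρ x =
      Real.pi / 2 - Real.arctan (Hyp.cotAngle (G.len x) (ρ (G.head x)) (ρ (G.tail x))) :=
  Hyp.angle_fermi _ (G.len_pos x) (by rw [sub_zero, abs_of_pos (G.len_pos x)]) (hρ _)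

theorem tailAngle_s₁ (G : MetricRibbonGraph X n) {ρ : G.Vertex → ℝ} (hρ : ∀ v, 0 < ρ v) (x : X) :
    G.tailAngle ρ (G.s₁ x) =
      Real.pi / 2 - Real.arctan (Hyp.cotAngle (G.len x) (ρ (G.head x)) (ρ (G.tail x))) := by
  have h := Hyp.angle_fermi (t := 0) (t' := G.len (G.s₁ x)) (ρ (G.head (G.s₁ x)))
    (G.len_pos (G.s₁ x)) (by rw [zero_sub, abs_neg, abs_of_pos (G.len_pos _)])
    (hρ (G.tail (G.s₁ x)))
  rw [G.len_s₁, G.tail_s₁] at h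
  rw [tailAngle, tailFoot, tailCorner, headCorner, G.len_s₁, G.tail_s₁]
  exact h

section Fintype

variable [Fintype X] (G : MetricRibbonGraph X n)

open Classical in
/-- Half of the total angle at the vertex `v`. -/
def halfAngle (ρ : G.Vertex → ℝ) (v : G.Vertex) : ℝ :=
  ∑ x ∈ Finset.univ.filter (fun x => G.head x = v),
    (Real.pi / 2 - Real.arctan (Hyp.cotAngle (G.len x) (ρ (G.head x)) (ρ (G.tail x))))

/-- The two corners at an end of an edge are equal, which accounts for the factor `2`. Unlike the
angles themselves, `halfAngle` is given by one continuous formula for all `ρ`, positive or not. -/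
theorem isRibLengths_iff (ρ : G.Vertex → ℝ) :
    G.IsRibLengths ρ ↔ (∀ v, 0 < ρ v) ∧ ∀ v, G.halfAngle ρ v = Real.pi := by
  refine and_congr_right fun hρ => forall_congr' fun v => ?_
  have : ∀ x, G.headAngle ρ x + G.tailAngle ρ (G.s₁ x) = 2 *
      (Real.pi / 2 - Real.arctan (Hyp.cotAngle (G.len x) (ρ (G.head x)) (ρ (G.tail x)))) := by
    intro x
    rw [G.headAngle_eq hρ, G.tailAngle_s₁ hρ, two_mul]
  simp only [this, ← Finset.mul_sum]
  rw [halfAngle]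
  constructor
  · intro h; linarith
  · intro h; rw [h]

theorem continuous_halfAngle (v : G.Vertex) : Continuous fun ρ => G.halfAngle ρ v := by
  refine continuous_finsetSum _ fun x _ => continuous_const.sub (Real.continuous_arctan.comp ?_)
  exact (Hyp.continuous_cotAngle (G.len x)).comp
    (.prodMk (continuous_apply (A := fun _ => ℝ) (G.head x))
      (continuous_apply (A := fun _ => ℝ) (G.tail x)))

theorem halfAngle_mono {ρ ρ' : G.Vertex → ℝ} (h : ρ ≤ ρ') {v : G.Vertex} (hv : ρ v = ρ' v) :
    G.halfAngle ρ v ≤ G.halfAngle ρ' v := by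
  classical
  refine Finset.sum_le_sum fun x hx => ?_
  have hx : G.head x = v := (Finset.mem_filter.1 hx).2
  rw [hx, hv]
  gcongr
  exact Hyp.cotAngle_antitone (G.len_pos x) _ (h _)

/-- A bound for rib lengths for which the angles at all vertices are at least `2π`. -/
theorem sinh_le_of_pi_le_halfAngle [Nonempty X] {κ : ℝ} (hκ : 0 < κ)
    (hlen : ∀ x, κ ≤ Real.tanh (G.len x / 2)) {ρ : G.Vertex → ℝ} (hρ : ∀ v, 0 < ρ v)
    (h : ∀ v, Real.pi ≤ G.halfAngle ρ v) (v : G.Vertex) :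
    Real.sinh (ρ v) ≤ Real.tan (Real.pi / 2 - Real.pi / Fintype.card X) / κ := by
  classical
  have : Nonempty G.Vertex := ⟨v⟩
  -- It suffices to bound the longest rib.
  obtain ⟨w, hw⟩ := Finite.exists_max ρ
  have hc : (1 : ℝ) < Fintype.card X := by exact_mod_cast G.one_lt_card
  have hpi := Real.pi_pos
  -- Pigeonhole: at most `Fintype.card X` terms add up to at least `π`.
  obtain ⟨x, hx, hxa⟩ : ∃ x, G.head x = w ∧ Real.pi / Fintype.card X ≤
      Real.pi / 2 - Real.arctan (Hyp.cotAngle (G.len x) (ρ (G.head x)) (ρ (G.tail x))) := by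
    by_contra! hcon
    refine absurd (h w) (not_le.2 ?_)
    obtain ⟨y, hy⟩ := G.exists_head_eq w
    have hlt : G.halfAngle ρ w < ∑ x ∈ Finset.univ.filter (fun x => G.head x = w),
        Real.pi / Fintype.card X :=
      Finset.sum_lt_sum_of_nonempty ⟨y, by simp [hy]⟩ fun x hx => hcon x (Finset.mem_filter.1 hx).2
    refine hlt.trans_le ?_
    rw [Finset.sum_const, nsmul_eq_mul]
    have : ((Finset.univ.filter (fun x => G.head x = w)).card : ℝ) ≤ Fintype.card X := by
      exact_mod_cast Finset.card_le_univ _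
    calc _ ≤ (Fintype.card X : ℝ) * (Real.pi / Fintype.card X) := by gcongr
      _ = Real.pi := by field_simp
  have h1 : Real.pi / Fintype.card X < Real.pi := div_lt_self hpi hc
  have h2 : 0 < Real.pi / Fintype.card X := by positivity
  have h3 : Hyp.cotAngle (G.len x) (ρ (G.head x)) (ρ (G.tail x)) ≤
      Real.tan (Real.pi / 2 - Real.pi / Fintype.card X) := by
    rw [← Real.arctan_strictMono.le_iff_le, Real.arctan_tan (by linarith) (by linarith)]
    linarith
  -- Since `w` has the longest rib, replacing the opposite rib by it lowers the cotangent to `sinh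
  -- (ρ w) * tanh (len / 2)`.
  have h4 := Hyp.cotAngle_antitone (G.len_pos x) (ρ (G.head x)) (hx ▸ hw (G.tail x))
  rw [Hyp.cotAngle_self (G.len_pos x), hx] at h4
  have h5 : Real.sinh (ρ v) ≤ Real.sinh (ρ w) := Real.sinh_le_sinh.2 (hw v)
  have h6 : 0 < Real.sinh (ρ w) := Real.sinh_pos_iff.2 (hρ w)
  rw [le_div_iff₀ hκ]
  rw [hx] at h3
  have h7 := mul_le_mul_of_nonneg_left (hlen x) h6.le
  nlinarith

theorem three_le_card_head (v : G.Vertex) [DecidablePred fun x => G.head x = v] :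
    3 ≤ (Finset.univ.filter (fun x => G.head x = v)).card := by
  classical
  obtain ⟨x, rfl⟩ := G.exists_head_eq v
  have h3 : ({x, G.s₀ x, G.s₀ (G.s₀ x)} : Finset X).card = 3 :=
    Finset.card_eq_three.2 ⟨_, _, _, (G.s₀_ne x).symm, (G.s₀_s₀_ne x).symm, (G.s₀_ne _).symm, rfl⟩
  rw [← h3]
  refine Finset.card_le_card fun y hy => ?_
  simp only [Finset.mem_insert, Finset.mem_singleton] at hy
  rcases hy with rfl | rfl | rfl <;> simp [RibbonGraph.head_s₀]

/-- For equal ribs with `sinh c = tan (π / 6)`, `cotAngle_self` makes every corner at least `π / 3`,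
and each vertex has degree at least three. This starts the Perron argument. -/
theorem pi_le_halfAngle_const (v : G.Vertex) :
    Real.pi ≤ G.halfAngle (fun _ => Real.arsinh (1 / √3)) v := by
  classical
  have h : ∀ x ∈ Finset.univ.filter (fun x => G.head x = v), Real.pi / 3 ≤ Real.pi / 2 -
      Real.arctan (Hyp.cotAngle (G.len x) (Real.arsinh (1 / √3)) (Real.arsinh (1 / √3))) := by
    intro x _
    have h1 : Hyp.cotAngle (G.len x) (Real.arsinh (1 / √3)) (Real.arsinh (1 / √3)) ≤
        Real.tan (Real.pi / 6) := by
      rw [Hyp.cotAngle_self (G.len_pos x), Real.sinh_arsinh, Real.tan_pi_div_six]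
      exact mul_le_of_le_one_right (by positivity) (Real.tanh_lt_one _).le
    have h2 := Real.arctan_strictMono.monotone h1
    rw [Real.arctan_tan (by linarith [Real.pi_pos]) (by linarith [Real.pi_pos])] at h2
    linarith
  have h1 := Finset.card_nsmul_le_sum _ _ _ h
  rw [nsmul_eq_mul] at h1
  have h2 : (3 : ℝ) ≤ (Finset.univ.filter (fun x => G.head x = v)).card := by
    exact_mod_cast G.three_le_card_head v
  calc Real.pi = 3 * (Real.pi / 3) := by ring
    _ ≤ (Finset.univ.filter (fun x => G.head x = v)).card * (Real.pi / 3) := by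
      have := Real.pi_pos
      gcongr
    _ ≤ _ := h1

theorem exists_pos_le_tanh_len [Nonempty X] : ∃ κ > 0, ∀ x, κ ≤ Real.tanh (G.len x / 2) := by
  obtain ⟨x, hx⟩ := Finite.exists_min fun x => Real.tanh (G.len x / 2)
  exact ⟨_, Hyp.tanh_pos_of_pos (half_pos (G.len_pos x)), hx⟩

/-- Perron's method: maximise the total rib length over families whose half angle sums are all at
least `π`. If the sum at `v` were larger, the rib at `v` could be lengthened slightly: continuity
controls the sum at `v`, and the other sums do not decrease. -/
theorem exists_isRibLengths [Nonempty X] : ∃ ρ, G.IsRibLengths ρ := by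
  classical
  have := Fintype.ofFinite G.Vertex
  obtain ⟨κ, hκ, hlen⟩ := G.exists_pos_le_tanh_len
  set c := Real.arsinh (1 / √3) with hc
  have hc0 : 0 < c := Real.arsinh_pos_iff.2 (by positivity)
  set R := Real.arsinh (Real.tan (Real.pi / 2 - Real.pi / Fintype.card X) / κ) with hR
  -- The upper bound `R` follows from the other constraints, so it makes `K` compact without
  -- obstructing the variation.
  have hbound : ∀ ρ : G.Vertex → ℝ, (∀ v, c ≤ ρ v) → (∀ v, Real.pi ≤ G.halfAngle ρ v) →
      ∀ v, ρ v ≤ R := by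
    intro ρ hρ h v
    rw [← Real.sinh_le_sinh, hR, Real.sinh_arsinh]
    exact G.sinh_le_of_pi_le_halfAngle hκ hlen (fun v => hc0.trans_le (hρ v)) h v
  let K : Set (G.Vertex → ℝ) :=
    Set.univ.pi (fun _ => Set.Icc c R) ∩ ⋂ v, {ρ | Real.pi ≤ G.halfAngle ρ v}
  have hK : IsCompact K := (isCompact_univ_pi fun _ => isCompact_Icc).inter_right
    (isClosed_iInter fun v => isClosed_le continuous_const (G.continuous_halfAngle v))
  have hmem : ∀ ρ : G.Vertex → ℝ, (∀ v, c ≤ ρ v) → (∀ v, Real.pi ≤ G.halfAngle ρ v) → ρ ∈ K :=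
    fun ρ h1 h2 => ⟨fun v _ => ⟨h1 v, hbound ρ h1 h2 v⟩, Set.mem_iInter.2 h2⟩
  obtain ⟨ρ, hρ, hmax⟩ := hK.exists_isMaxOn
    ⟨fun _ => c, hmem _ (fun _ => le_rfl) G.pi_le_halfAngle_const⟩
    (f := fun ρ => ∑ v, ρ v) (by fun_prop)
  have hρc : ∀ v, c ≤ ρ v := fun v => (hρ.1 v trivial).1
  have hρa : ∀ v, Real.pi ≤ G.halfAngle ρ v := Set.mem_iInter.1 hρ.2
  refine ⟨ρ, (G.isRibLengths_iff ρ).2 ⟨fun v => hc0.trans_le (hρc v), fun v => ?_⟩⟩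
  refine le_antisymm (not_lt.1 fun hlt => ?_) (hρa v)
  have hcont : Continuous fun s => G.halfAngle (Function.update ρ v s) v :=
    (G.continuous_halfAngle v).comp (continuous_const.update v continuous_id)
  have hev : ∀ᶠ s in 𝓝[>] (ρ v), Real.pi < G.halfAngle (Function.update ρ v s) v :=
    (hcont.tendsto (ρ v)).eventually_const_lt (by simpa using hlt) |>.filter_mono
      nhdsWithin_le_nhds
  obtain ⟨s, hs, hsv⟩ := (hev.and self_mem_nhdsWithin).exists
  have hsv : ρ v < s := hsv
  have hle : ρ ≤ Function.update ρ v s := by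
    intro w
    rcases eq_or_ne w v with rfl | hw
    · simpa using hsv.le
    · simp [hw]
  have hin : Function.update ρ v s ∈ K := by
    refine hmem _ (fun w => (hρc w).trans (hle w)) fun w => ?_
    rcases eq_or_ne w v with rfl | hw
    · exact hs.le
    · exact (hρa w).trans (G.halfAngle_mono hle (by simp [hw]))
  have h1 : ∑ w, Function.update ρ v s w ≤ ∑ w, ρ w := hmax hin
  refine absurd h1 (not_le.2 ?_)
  exact Finset.sum_lt_sum (fun w _ => hle w) ⟨v, Finset.mem_univ _, by simpa using hsv⟩

/-- Maximum principle: let `w` maximise the difference of the Gudermannians of `ρ'` and `ρ`. If it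
is positive there, `cotAngle_lt` makes every corner at `w` strictly smaller for `ρ'`, although both
sums are `π`. -/
theorem IsRibLengths.le {G : MetricRibbonGraph X n} {ρ ρ' : G.Vertex → ℝ} (h : G.IsRibLengths ρ)
    (h' : G.IsRibLengths ρ') : ρ' ≤ ρ := by
  classical
  intro v
  have : Nonempty G.Vertex := ⟨v⟩
  rw [isRibLengths_iff] at h h'
  let u : (G.Vertex → ℝ) → G.Vertex → ℝ := fun ρ v => Real.arctan (Real.sinh (ρ v))
  obtain ⟨w, hw⟩ := Finite.exists_max fun v => u ρ' v - u ρ v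
  have hu : ∀ v, u ρ' v ≤ u ρ v → ρ' v ≤ ρ v := fun v hv =>
    Real.sinh_le_sinh.1 (Real.arctan_strictMono.le_iff_le.1 hv)
  rcases le_or_gt (u ρ' w) (u ρ w) with hle | hlt
  · exact hu v (by linarith [hw v])
  · exfalso
    have hlt' : G.halfAngle ρ' w < G.halfAngle ρ w := by
      obtain ⟨y, hy⟩ := G.exists_head_eq w
      refine Finset.sum_lt_sum_of_nonempty ⟨y, by simp [hy]⟩ fun x hx => ?_
      have hx : G.head x = w := (Finset.mem_filter.1 hx).2
      have := Hyp.cotAngle_lt (r₂ := ρ' (G.head x)) (G.len_pos x) (h.1 (G.head x)) (h'.1 (G.tail x))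
        (by rw [hx]; exact hlt) (by rw [hx]; exact hw _)
      linarith [Real.arctan_strictMono this]
    rw [h.2, h'.2] at hlt'
    exact lt_irrefl _ hlt'

theorem existsUnique_isRibLengths [Nonempty X] : ∃! ρ, G.IsRibLengths ρ :=
  existsUnique_of_exists_of_unique G.exists_isRibLengths fun _ _ h h' =>
    le_antisymm (h'.le h) (h.le h')

theorem isRibLengths_ribLengths [Nonempty X] : G.IsRibLengths G.ribLengths :=
  Classical.epsilon_spec G.exists_isRibLengths

/-- The rib lengths of `N Γ` are bounded independently of `N ≥ 1`. -/
theorem exists_ribLengths_scale_le [Nonempty X] :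
    ∃ R, 0 < R ∧ ∀ N : PosReal, (1 : ℝ) ≤ N → ∀ v, (G.scale N).ribLengths v ≤ R := by
  obtain ⟨κ, hκ, hlen⟩ := G.exists_pos_le_tanh_len
  refine ⟨max 1 (Real.arsinh (Real.tan (Real.pi / 2 - Real.pi / Fintype.card X) / κ)),
    lt_max_of_lt_left one_pos, fun N hN v => le_max_of_le_right ?_⟩
  have h := ((G.scale N).isRibLengths_iff _).1 (G.scale N).isRibLengths_ribLengths
  rw [← Real.sinh_le_sinh, Real.sinh_arsinh]
  -- For `N ≥ 1` the edges only get longer, so the same `κ` serves for every `N`.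
  refine (G.scale N).sinh_le_of_pi_le_halfAngle hκ (fun x => (hlen x).trans ?_) h.1
    (fun v => (h.2 v).ge) v
  apply Hyp.tanh_monotone
  have : G.len x ≤ N * G.len x := le_mul_of_one_le_left (G.len_pos x).le hN
  change G.len x / 2 ≤ N * G.len x / 2
  linarith

end Fintype

end MetricRibbonGraph

/-! ## Maps between glued spaces -/

namespace GluingData

variable {ι Y : Type*} [PseudoEMetricSpace Y]

/-- A map from a glued space is Lipschitz if it is so on every piece and respects the gluing. -/
theorem lipschitzWith_of_piece (D : GluingData ι Y) {Z : Type*} [PseudoEMetricSpace Z]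
    {f : D.Point → Z} {K : NNReal} (hK : K ≠ 0)
    (hg : ∀ p q, D.glue p.idx p.pt q.idx q.pt → edist (f p) (f q) = 0)
    (hp : ∀ p q, p.idx = q.idx → edist (f p) (f q) ≤ K * edist p.pt q.pt) : LipschitzWith K f := by
  -- Forbidden steps cost `⊤`, and `0 * ⊤ = 0` would make their bound fail.
  have hK' : (K : ℝ≥0∞) ≠ 0 := ENNReal.coe_ne_zero.2 hK
  have hstep : ∀ p q, edist (f p) (f q) ≤ K * D.step p q := by
    intro p q
    unfold step
    split_ifs with h1 h2
    · rcases h1 with h | h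
      · simp [hg p q h]
      · simp [edist_comm (f p), hg q p h]
    · exact hp p q h2
    · simp [ENNReal.mul_top hK']
  have hchain : ∀ (l : List D.Point) p q, edist (f p) (f q) ≤ K * D.chainLength p l q := by
    intro l
    induction l with
    | nil => exact hstep
    | cons a l ih =>
      intro p q
      rw [chainLength, mul_add]
      exact (edist_triangle _ (f a) _).trans (add_le_add (hstep p a) (ih a q))
  intro p q
  change _ ≤ (K : ℝ≥0∞) * ⨅ l : List D.Point, D.chainLength p l q
  rw [ENNReal.mul_iInf_of_ne hK' ENNReal.coe_ne_top]
  exact le_iInf fun l => hchain l p q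

end GluingData

/-! ### Segments parametrised by arc length -/

namespace Hyp

/-- The point of the geodesic segment from `A` to `B` at distance `p` from `A`. -/
def geod (A B : ℍ) : ℝ → ℍ := (exists_geodesic A B).choose

theorem geod_zero (A B : ℍ) : geod A B 0 = A := (exists_geodesic A B).choose_spec.1

theorem geod_dist (A B : ℍ) : geod A B (dist A B) = B := (exists_geodesic A B).choose_spec.2.1

theorem dist_geod_le (A B : ℍ) (s t : ℝ) : dist (geod A B s) (geod A B t) ≤ |s - t| :=
  (exists_geodesic A B).choose_spec.2.2 s t

/-- The curve is only known to be 1-Lipschitz; the triangle inequality turns both bounds into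
equalities between the end points. -/
theorem dist_geod {A B : ℍ} {p : ℝ} (h0 : 0 ≤ p) (h1 : p ≤ dist A B) :
    dist A (geod A B p) = p ∧ dist (geod A B p) B = dist A B - p := by
  have e1 := dist_geod_le A B 0 p
  have e2 := dist_geod_le A B p (dist A B)
  rw [geod_zero, zero_sub, abs_neg, abs_of_nonneg h0] at e1
  rw [geod_dist, abs_sub_comm, abs_of_nonneg (sub_nonneg.2 h1)] at e2
  have e3 := dist_triangle A (geod A B p) B
  constructor <;> linarith

theorem geod_mem_seg {A B : ℍ} {p : ℝ} (h0 : 0 ≤ p) (h1 : p ≤ dist A B) :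
    geod A B p ∈ seg A B := by
  obtain ⟨e1, e2⟩ := dist_geod h0 h1
  change _ + _ = _
  rw [e1, e2]
  ring

theorem geod_of_mem_seg {A B y : ℍ} (hy : y ∈ seg A B) : geod A B (dist A y) = y := by
  have h : dist A y + dist y B = dist A B := hy
  have h1 : dist A y ≤ dist A B := by linarith [dist_nonneg (x := y) (y := B)]
  exact eq_of_mem_seg (geod_mem_seg dist_nonneg h1) hy (dist_geod dist_nonneg h1).1

end Hyp

namespace MetricRibbonGraph

variable {X : Type*} {n : ℕ}

theorem proj_mem_Icc (H : MetricRibbonGraph X n) {ρ : H.Vertex → ℝ} (hρ : ∀ v, 0 < ρ v) {x : X}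
    {z : ℍ} (hz : z ∈ H.piece ρ x) : 0 ≤ Hyp.proj z ∧ Hyp.proj z ≤ H.len x := by
  obtain ⟨y, hy, h, -⟩ := Hyp.exists_spine_of_mem_quad (H.len_pos x) (hρ _).le (hρ _).le
    (le_max_left _ _) (le_max_right _ _) hz
  have := Hyp.spine_bounds' (H.len_pos x) (hρ _).le (hρ _).le
    (le_max_left _ _) (le_max_right _ _) hy
  rw [h]
  exact ⟨this.1, this.2.1⟩

theorem spineSide_subset_piece (H : MetricRibbonGraph X n) (ρ : H.Vertex → ℝ) (x : X) :
    H.spineSide ρ x ⊆ H.piece ρ x := fun z hz => ⟨z, hz, Hyp.right_mem_seg _ _⟩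

/-- The length of the edge of the spine. -/
def spineLength (H : MetricRibbonGraph X n) (ρ : H.Vertex → ℝ) (x : X) : ℝ :=
  dist (H.tailCorner ρ x) (H.headCorner ρ x)

theorem spineLength_s₁ (H : MetricRibbonGraph X n) (ρ : H.Vertex → ℝ) (x : X) :
    H.spineLength ρ (H.s₁ x) = H.spineLength ρ x := by
  rw [spineLength, tailCorner, headCorner, H.tail_s₁, H.len_s₁]
  exact Hyp.dist_corners_comm _ _ _

theorem len_le_spineLength (H : MetricRibbonGraph X n) (ρ : H.Vertex → ℝ) (x : X) :
    H.len x ≤ H.spineLength ρ x := Hyp.le_dist_corners _ _ _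

theorem spineLength_le (H : MetricRibbonGraph X n) {ρ : H.Vertex → ℝ} {R : ℝ} (hρ : ∀ v, 0 < ρ v)
    (hR : ∀ v, ρ v ≤ R) (x : X) : H.spineLength ρ x ≤ H.len x + 2 * R := by
  have h1 : H.spineLength ρ x ≤ ρ (H.tail x) + H.len x + ρ (H.head x) :=
    Hyp.dist_corners_le (H.len_pos x) (hρ _).le (hρ _).le
  linarith [hR (H.tail x), hR (H.head x)]

/-- The head corners of the quadrilaterals at a vertex are identified in the glued surface. -/
theorem edist_headCorner_eq_zero (H : MetricRibbonGraph X n) (ρ : H.Vertex → ℝ) {x y : X}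
    (h : H.head x = H.head y) :
    edist (⟨x, H.headCorner ρ x, H.headCorner_mem_piece ρ x⟩ : (H.surfaceGluing ρ).Point)
      ⟨y, H.headCorner ρ y, H.headCorner_mem_piece ρ y⟩ = 0 := by
  let D := H.surfaceGluing ρ
  let e : X → D.Point := fun x => ⟨x, H.headCorner ρ x, H.headCorner_mem_piece ρ x⟩
  let e' : X → D.Point := fun x => ⟨x, H.tailCorner ρ x, H.tailCorner_mem_piece ρ x⟩
  have htrans : ∀ {a b c : D.Point}, edist a b = 0 → edist b c = 0 → edist a c = 0 := by
    intro a b c hab hbc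
    have := edist_triangle a b c
    rw [hab, hbc, add_zero] at this
    exact le_antisymm this zero_le
  have h1 : ∀ x, edist (e x) (e' (H.s₁ x)) = 0 := fun x => by
    rw [edist_comm]
    refine D.edist_eq_zero_of_glue (p := e' (H.s₁ x)) (q := e x) (Or.inl ⟨?_, ?_, ?_, ?_⟩)
    · exact (H.s₁_s₁ x).symm
    · exact Hyp.left_mem_seg _ _
    · exact Hyp.right_mem_seg _ _
    · exact (dist_self _).trans (dist_self _).symm
  have h2 : ∀ x, edist (e x) (e' (H.s₂ x)) = 0 := fun x =>
    D.edist_eq_zero_of_glue (p := e x) (q := e' (H.s₂ x))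
      (Or.inr ⟨rfl, Hyp.right_mem_seg _ _, Hyp.right_mem_seg _ _,
        (dist_self _).trans (dist_self _).symm⟩)
  -- The tail corner of `s₁ x = s₂ (s₀ x)` is glued to the head corner of `x` along the spine and to
  -- that of `s₀ x` along a rib.
  have h3 : ∀ x, edist (e x) (e (H.s₀ x)) = 0 := fun x => by
    have hs : H.s₂ (H.s₀ x) = H.s₁ x := by simp [RibbonGraph.s₂]
    refine htrans (h1 x) ?_
    rw [edist_comm, ← hs]
    exact h2 _
  have hnat : ∀ (k : ℕ) x, edist (e x) (e ((H.s₀ ^ k) x)) = 0 := by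
    intro k
    induction k with
    | zero => intro x; simp
    | succ k ih =>
      intro x
      rw [pow_succ', Equiv.Perm.mul_apply]
      exact htrans (ih x) (h3 _)
  obtain ⟨k, hk⟩ : Equiv.Perm.SameCycle H.s₀ x y := Quotient.exact h
  change edist (e x) (e y) = 0
  obtain ⟨k, rfl | rfl⟩ := k.eq_nat_or_neg
  · rw [← hk, zpow_natCast]
    exact hnat k x
  · have : x = (H.s₀ ^ k) y := by
      rw [← hk, zpow_neg, zpow_natCast]
      exact (Equiv.apply_symm_apply (H.s₀ ^ k) x).symm
    rw [this, edist_comm]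
    exact hnat k y

/-! ### Comparison maps between the glued surface and the graph -/

section Scale

variable (Γ : MetricRibbonGraph X n) (N : PosReal) {ρ : (Γ.scale N).Vertex → ℝ}

theorem len_scale (x : X) : (Γ.scale N).len x = N * Γ.len x := rfl

/-- The projection of the glued surface to the graph, along the perpendiculars to the bases of the
quadrilaterals. -/
def toGraph (hρ : ∀ v, 0 < ρ v) (p : ((Γ.scale N).surfaceGluing ρ).Point) :
    Γ.graphGluing.Point where
  idx := p.idx
  pt := (N : ℝ)⁻¹ * Hyp.proj p.pt
  mem := by
    have h := (Γ.scale N).proj_mem_Icc hρ p.mem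
    rw [len_scale] at h
    have hN := N.2
    refine ⟨mul_nonneg (inv_nonneg.2 hN.le) h.1, ?_⟩
    rw [inv_mul_le_iff₀ hN]
    exact h.2

theorem spine_param_mem {x : X} {a : ℝ} (h : a ∈ Γ.graphGluing.piece x) :
    0 ≤ a * ((Γ.scale N).spineLength ρ x / Γ.len x) ∧
      a * ((Γ.scale N).spineLength ρ x / Γ.len x) ≤ (Γ.scale N).spineLength ρ x := by
  have hl := Γ.len_pos x
  have hd : 0 ≤ (Γ.scale N).spineLength ρ x := dist_nonneg
  refine ⟨mul_nonneg h.1 (by positivity), ?_⟩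
  rw [mul_div_assoc', div_le_iff₀ hl, mul_comm]
  exact mul_le_mul_of_nonneg_left h.2 hd

/-- The map from the graph to the spine of the glued surface, linear on each edge. -/
def toSpine (ρ : (Γ.scale N).Vertex → ℝ) (p : Γ.graphGluing.Point) :
    ((Γ.scale N).surfaceGluing ρ).Point where
  idx := p.idx
  pt := Hyp.geod ((Γ.scale N).tailCorner ρ p.idx) ((Γ.scale N).headCorner ρ p.idx)
    (p.pt * ((Γ.scale N).spineLength ρ p.idx / Γ.len p.idx))
  mem := by
    obtain ⟨h0, h1⟩ := Γ.spine_param_mem N (ρ := ρ) p.mem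
    exact (Γ.scale N).spineSide_subset_piece ρ _ (Hyp.geod_mem_seg h0 h1)

/-- On a piece this is the contraction `proj` divided by `N`. Points glued along the spine have
projections adding up to the length of the base (`proj_add_proj`), and ribs project to end points of
bases, that is, to vertices. -/
theorem lipschitzWith_toGraph (hρ : ∀ v, 0 < ρ v) :
    LipschitzWith ⟨(N : ℝ)⁻¹, inv_nonneg.2 N.2.le⟩ (Γ.toGraph N hρ) := by
  have hN := N.2
  apply GluingData.lipschitzWith_of_piece
  · intro h
    exact (inv_pos.2 hN).ne' (congrArg NNReal.toReal h)
  · rintro ⟨x, a, ha⟩ ⟨y, b, hb⟩ (⟨rfl, h1, h2, h3⟩ | ⟨rfl, h1, h2, h3⟩)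
    · apply GluingData.edist_eq_zero_of_glue
      refine Or.inl ⟨rfl, ?_⟩
      change (N : ℝ)⁻¹ * Hyp.proj a + (N : ℝ)⁻¹ * Hyp.proj b = Γ.len x
      dsimp only at h1 h2 h3
      rw [spineSide, tailCorner, headCorner, (Γ.scale N).tail_s₁, (Γ.scale N).len_s₁] at h2
      rw [tailCorner, headCorner, (Γ.scale N).len_s₁] at h3
      have := Hyp.proj_add_proj h1 h2 h3
      rw [← mul_add, this, len_scale]
      field_simp
    · have e1 : Hyp.proj a = N * Γ.len x := Hyp.proj_eq_of_mem_seg h1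
      have e2 : Hyp.proj b = 0 := Hyp.proj_eq_of_mem_seg h2
      set y := (Γ.scale N).s₂ x with hy
      -- The graph gluing matches only head ends or reversed edges, so the head end of `x` and the
      -- tail end of `y` are joined through the head end of `s₁ y = s₀⁻¹ x`.
      let r : Γ.graphGluing.Point := ⟨Γ.s₁ y, Γ.len (Γ.s₁ y), (Γ.len_pos _).le, le_rfl⟩
      have g1 : edist (Γ.toGraph N hρ ⟨x, a, ha⟩) r = 0 := by
        apply GluingData.edist_eq_zero_of_glue
        refine Or.inr ⟨?_, ?_, rfl⟩
        · have : Γ.s₁ y = Γ.s₀⁻¹ x := Γ.s₁_s₁ _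
          change Γ.head x = Γ.head (Γ.s₁ y)
          rw [this, ← Γ.head_s₀ (Γ.s₀⁻¹ x)]
          exact congrArg Γ.head (Equiv.apply_symm_apply Γ.s₀ x).symm
        · change (N : ℝ)⁻¹ * Hyp.proj a = Γ.len x
          rw [e1]
          field_simp
      have g2 : edist (Γ.toGraph N hρ ⟨y, b, hb⟩) r = 0 := by
        apply GluingData.edist_eq_zero_of_glue
        refine Or.inl ⟨rfl, ?_⟩
        change (N : ℝ)⁻¹ * Hyp.proj b + Γ.len (Γ.s₁ y) = Γ.len y
        rw [e2, Γ.len_s₁]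
        ring
      have := edist_triangle_right (Γ.toGraph N hρ ⟨x, a, ha⟩) (Γ.toGraph N hρ ⟨y, b, hb⟩) r
      rw [g1, g2, add_zero] at this
      exact le_antisymm this zero_le
  · rintro ⟨x, a, ha⟩ ⟨y, b, hb⟩ (rfl : x = y)
    refine (Γ.graphGluing.edist_le_of_piece _ _).trans ?_
    have hlip : LipschitzWith ⟨(N : ℝ)⁻¹, inv_nonneg.2 N.2.le⟩
        (fun z : ℍ => (N : ℝ)⁻¹ * Hyp.proj z) := by
      refine LipschitzWith.of_dist_le_mul fun z w => ?_
      rw [Real.dist_eq, ← mul_sub, abs_mul, abs_of_pos (inv_pos.2 hN)]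
      exact mul_le_mul_of_nonneg_left (Hyp.abs_proj_sub_le z w) (inv_pos.2 hN).le
    exact hlip a b

/-- An edge of length `len` is stretched onto a spine side of length at most `N * len + 2 * R`,
hence by a factor at most `N + 2 * R / m`. -/
theorem lipschitzWith_toSpine {m R : ℝ} (hρ : ∀ v, 0 < ρ v) (hρR : ∀ v, ρ v ≤ R) (hR : 0 < R)
    (hm : 0 < m) (hlen : ∀ x, m ≤ Γ.len x) :
    LipschitzWith ⟨N + 2 * R / m, by have := N.2; positivity⟩ (Γ.toSpine N ρ) := by
  have hN := N.2
  apply GluingData.lipschitzWith_of_piece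
  · intro h
    have : (0 : ℝ) < N + 2 * R / m := by positivity
    exact this.ne' (congrArg NNReal.toReal h)
  · rintro ⟨x, a, ha⟩ ⟨y, b, hb⟩ (⟨rfl, h⟩ | ⟨h1, h2, h3⟩)
    · apply GluingData.edist_eq_zero_of_glue
      have pa := Γ.spine_param_mem N (ρ := ρ) ha
      have pb := Γ.spine_param_mem N (ρ := ρ) hb
      refine Or.inl ⟨rfl, Hyp.geod_mem_seg pa.1 pa.2, Hyp.geod_mem_seg pb.1 pb.2, ?_⟩
      refine (dist_comm _ _).trans ((Hyp.dist_geod pa.1 pa.2).1.trans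
        (Eq.trans ?_ (Hyp.dist_geod pb.1 pb.2).2.symm))
      change a * ((Γ.scale N).spineLength ρ x / Γ.len x) = (Γ.scale N).spineLength ρ (Γ.s₁ x) -
        b * ((Γ.scale N).spineLength ρ (Γ.s₁ x) / Γ.len (Γ.s₁ x))
      have e : (Γ.scale N).spineLength ρ (Γ.s₁ x) = (Γ.scale N).spineLength ρ x :=
        (Γ.scale N).spineLength_s₁ ρ x
      have hl := Γ.len_pos x
      have ha' : a = Γ.len x - b := by
        have : a + b = Γ.len x := h
        linarith
      rw [e, Γ.len_s₁, ha']
      field_simp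
    · have key : ∀ (x : X) (a : ℝ) (ha : a ∈ Γ.graphGluing.piece x), a = Γ.len x →
          Γ.toSpine N ρ ⟨x, a, ha⟩ = ⟨x, (Γ.scale N).headCorner ρ x,
            (Γ.scale N).headCorner_mem_piece ρ x⟩ := by
        intro x a ha h
        have hl := Γ.len_pos x
        have e : a * ((Γ.scale N).spineLength ρ x / Γ.len x) = (Γ.scale N).spineLength ρ x := by
          rw [h]
          field_simp
        simp only [toSpine, e]
        congr 1
        exact Hyp.geod_dist _ _
      rw [key x a ha h2, key y b hb h3]
      exact (Γ.scale N).edist_headCorner_eq_zero ρ h1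
  · rintro ⟨x, a, ha⟩ ⟨y, b, hb⟩ (rfl : x = y)
    refine (((Γ.scale N).surfaceGluing ρ).edist_le_of_piece _ _).trans ?_
    have hl := Γ.len_pos x
    have hc : (Γ.scale N).spineLength ρ x / Γ.len x ≤ N + 2 * R / m := by
      have h1 := (Γ.scale N).spineLength_le hρ hρR x
      rw [len_scale] at h1
      calc _ ≤ (N * Γ.len x + 2 * R) / Γ.len x := by gcongr
        _ = N + 2 * R / Γ.len x := by field_simp
        _ ≤ N + 2 * R / m := by
          have := hlen x
          gcongr
    have hd : 0 ≤ (Γ.scale N).spineLength ρ x := dist_nonneg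
    have hlip : LipschitzWith ⟨N + 2 * R / m, by positivity⟩
        (fun a : ℝ => Hyp.geod ((Γ.scale N).tailCorner ρ x) ((Γ.scale N).headCorner ρ x)
          (a * ((Γ.scale N).spineLength ρ x / Γ.len x))) := by
      refine LipschitzWith.of_dist_le_mul fun s t => (Hyp.dist_geod_le _ _ _ _).trans ?_
      rw [← sub_mul, abs_mul, abs_of_nonneg (div_nonneg hd hl.le), mul_comm, Real.dist_eq]
      exact mul_le_mul_of_nonneg_right hc (abs_nonneg _)
    exact hlip a b

/-- The constant is `R + 2R + 2R`: from the point to the spine along its perpendicular, from arc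
length on the spine to projection, and from projection to the linear parameter of the spine side. -/
theorem edist_toSpine_toGraph_le {R : ℝ} (hρ : ∀ v, 0 < ρ v) (hρR : ∀ v, ρ v ≤ R)
    (p : ((Γ.scale N).surfaceGluing ρ).Point) :
    edist p (Γ.toSpine N ρ (Γ.toGraph N hρ p)) ≤ ENNReal.ofReal (5 * R) := by
  obtain ⟨x, z, hz⟩ := p
  refine (((Γ.scale N).surfaceGluing ρ).edist_le_of_piece _ _).trans ?_
  rw [edist_dist]
  apply ENNReal.ofReal_le_ofReal
  obtain ⟨y, hy, hzy, hdist⟩ := Hyp.exists_spine_of_mem_quad ((Γ.scale N).len_pos x) (hρ _).le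
    (hρ _).le (hρR _) (hρR _) hz
  obtain ⟨b1, b2, -, b3⟩ := Hyp.spine_bounds' ((Γ.scale N).len_pos x) (hρ _).le
    (hρ _).le (hρR _) (hρR _) hy
  have hN := N.2
  have hl := Γ.len_pos x
  have h1 := (Γ.scale N).spineLength_le hρ hρR x
  have h2 := (Γ.scale N).len_le_spineLength ρ x
  have h3 := Hyp.dist_geod_le ((Γ.scale N).tailCorner ρ x) ((Γ.scale N).headCorner ρ x)
    (dist ((Γ.scale N).tailCorner ρ x) y)
    ((N : ℝ)⁻¹ * Hyp.proj z * ((Γ.scale N).spineLength ρ x / Γ.len x))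
  rw [show Hyp.geod ((Γ.scale N).tailCorner ρ x) ((Γ.scale N).headCorner ρ x)
    (dist ((Γ.scale N).tailCorner ρ x) y) = y from Hyp.geod_of_mem_seg hy, hzy] at h3
  rw [len_scale] at h1 h2 b2
  change dist z (Hyp.geod ((Γ.scale N).tailCorner ρ x) ((Γ.scale N).headCorner ρ x)
    ((N : ℝ)⁻¹ * Hyp.proj z * ((Γ.scale N).spineLength ρ x / Γ.len x))) ≤ 5 * R
  rw [hzy]
  refine (dist_triangle _ y _).trans ?_
  change |dist ((Γ.scale N).tailCorner ρ x) y - Hyp.proj y| ≤ 2 * R at b3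
  set d := (Γ.scale N).spineLength ρ x
  set t := Hyp.proj y
  have h4 : |t - (N : ℝ)⁻¹ * t * (d / Γ.len x)| ≤ 2 * R := by
    have e : (N : ℝ)⁻¹ * t * (d / Γ.len x) - t = t / (N * Γ.len x) * (d - N * Γ.len x) := by
      field_simp
    have e1 : t / (N * Γ.len x) ≤ 1 := (div_le_one (by positivity)).2 b2
    have e2 : 0 ≤ t / (N * Γ.len x) := by positivity
    rw [abs_sub_comm, e, abs_mul, abs_of_nonneg e2, abs_of_nonneg (by linarith)]
    nlinarith
  have h5 := abs_sub_le (dist ((Γ.scale N).tailCorner ρ x) y) t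
    ((N : ℝ)⁻¹ * t * (d / Γ.len x))
  linarith

/-- The two errors of `2R`, of the linear parameter and of the projection, divided by `N`. -/
theorem edist_toGraph_toSpine_le {R : ℝ} (hρ : ∀ v, 0 < ρ v) (hρR : ∀ v, ρ v ≤ R)
    (p : Γ.graphGluing.Point) :
    edist p (Γ.toGraph N hρ (Γ.toSpine N ρ p)) ≤ ENNReal.ofReal ((N : ℝ)⁻¹ * (4 * R)) := by
  obtain ⟨x, a, ha⟩ := p
  refine (Γ.graphGluing.edist_le_of_piece _ _).trans ?_
  rw [edist_dist]
  apply ENNReal.ofReal_le_ofReal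
  obtain ⟨p0, p1⟩ := Γ.spine_param_mem N (ρ := ρ) ha
  have hy := Hyp.geod_mem_seg p0 p1
  have hd := (Hyp.dist_geod p0 p1).1
  change dist a ((N : ℝ)⁻¹ * Hyp.proj (Hyp.geod ((Γ.scale N).tailCorner ρ x)
    ((Γ.scale N).headCorner ρ x) (a * ((Γ.scale N).spineLength ρ x / Γ.len x)))) ≤ _
  set y := Hyp.geod ((Γ.scale N).tailCorner ρ x)
    ((Γ.scale N).headCorner ρ x) (a * ((Γ.scale N).spineLength ρ x / Γ.len x))
  obtain ⟨b1, b2, -, b3⟩ := Hyp.spine_bounds' ((Γ.scale N).len_pos x) (hρ _).le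
    (hρ _).le (hρR _) (hρR _) hy
  change |dist ((Γ.scale N).tailCorner ρ x) y - Hyp.proj y| ≤ 2 * R at b3
  have hN := N.2
  have hl := Γ.len_pos x
  have h1 := (Γ.scale N).spineLength_le hρ hρR x
  have h2 := (Γ.scale N).len_le_spineLength ρ x
  rw [len_scale] at h1 h2
  rw [hd] at b3
  set d := (Γ.scale N).spineLength ρ x
  have h4 : |N * a - a * (d / Γ.len x)| ≤ 2 * R := by
    have e : a * (d / Γ.len x) - N * a = a / Γ.len x * (d - N * Γ.len x) := by
      field_simp
    have e1 : a / Γ.len x ≤ 1 := (div_le_one hl).2 ha.2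
    have e2 : 0 ≤ a / Γ.len x := div_nonneg ha.1 hl.le
    rw [abs_sub_comm, e, abs_mul, abs_of_nonneg e2, abs_of_nonneg (by linarith)]
    nlinarith
  have h5 := abs_sub_le (N * a) (a * (d / Γ.len x)) (Hyp.proj y)
  have e : a - (N : ℝ)⁻¹ * Hyp.proj y = (N : ℝ)⁻¹ * (N * a - Hyp.proj y) := by field_simp
  rw [Real.dist_eq, e, abs_mul, abs_of_pos (inv_pos.2 hN)]
  exact mul_le_mul_of_nonneg_left (by linarith) (inv_pos.2 hN).le

end Scale

/-! ### The Gromov–Hausdorff estimate -/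

/-- The point of the metric graph represented by a point of an edge. -/
def graphMk (G : MetricRibbonGraph X n) : G.graphGluing.Point → G.Graph := SeparationQuotient.mk

theorem graphMk_surjective (G : MetricRibbonGraph X n) : Function.Surjective G.graphMk :=
  SeparationQuotient.surjective_mk

theorem graph_point_edist_ne_top (G : MetricRibbonGraph X n) (p q : G.graphGluing.Point) :
    edist p q ≠ ⊤ := G.graph_edist_ne_top (G.graphMk p) (G.graphMk q)

/-- The point of the glued surface represented by a point of a quadrilateral. -/
def surfaceMk (G : MetricRibbonGraph X n) (ρ : G.Vertex → ℝ) :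
    (G.surfaceGluing ρ).Point → G.GluedSurface ρ := SeparationQuotient.mk

theorem surfaceMk_surjective (G : MetricRibbonGraph X n) (ρ : G.Vertex → ℝ) :
    Function.Surjective (G.surfaceMk ρ) := SeparationQuotient.surjective_mk

theorem surface_point_edist_ne_top (G : MetricRibbonGraph X n) (ρ : G.Vertex → ℝ)
    (p q : (G.surfaceGluing ρ).Point) : edist p q ≠ ⊤ :=
  G.surface_edist_ne_top ρ (G.surfaceMk ρ p) (G.surfaceMk ρ q)

theorem toReal_edist_le {α β : Type*} [PseudoEMetricSpace α] [PseudoEMetricSpace β] {f : α → β}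
    {K : NNReal} (hf : LipschitzWith K f) {p q : α} (h : edist p q ≠ ⊤) :
    (edist (f p) (f q)).toReal ≤ K * (edist p q).toReal := by
  have := ENNReal.toReal_mono (ENNReal.mul_ne_top ENNReal.coe_ne_top h) (hf p q)
  rwa [ENNReal.toReal_mul, ENNReal.coe_toReal] at this

/-- The distance between the rescaled glued surface and the graph. -/
theorem ghDist_rescaled_le [Finite X] [Nonempty X] (Γ : MetricRibbonGraph X n) (N : PosReal)
    {ρ : (Γ.scale N).Vertex → ℝ} {m R : ℝ} (hρ : ∀ v, 0 < ρ v) (hρR : ∀ v, ρ v ≤ R) (hR : 0 < R)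
    (hm : 0 < m) (hlen : ∀ x, m ≤ Γ.len x) :
    GromovHausdorff.ghDist (Rescaled N⁻¹ ((Γ.scale N).GluedSurface ρ)) Γ.Graph ≤
      (N : ℝ)⁻¹ * ((2 * R / m * Metric.diam (Set.univ : Set Γ.Graph) + 10 * R) / 2 + 4 * R) := by
  have hN := N.2
  have hN' := inv_pos.2 hN
  let s := (Γ.scale N).surfaceMk ρ
  let r : (Γ.scale N).GluedSurface ρ → ((Γ.scale N).surfaceGluing ρ).Point :=
    Function.surjInv ((Γ.scale N).surfaceMk_surjective ρ)
  have hr : ∀ u, s (r u) = u := Function.surjInv_eq ((Γ.scale N).surfaceMk_surjective ρ)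
  have L1 : ∀ p q, dist (Γ.graphMk (Γ.toGraph N hρ p)) (Γ.graphMk (Γ.toGraph N hρ q)) ≤
      (N : ℝ)⁻¹ * dist (s p) (s q) := fun p q =>
    toReal_edist_le (Γ.lipschitzWith_toGraph N hρ) ((Γ.scale N).surface_point_edist_ne_top ρ p q)
  have L2 : ∀ p q, dist (s (Γ.toSpine N ρ p)) (s (Γ.toSpine N ρ q)) ≤
      (N + 2 * R / m) * dist (Γ.graphMk p) (Γ.graphMk q) := fun p q =>
    toReal_edist_le (Γ.lipschitzWith_toSpine N hρ hρR hR hm hlen)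
      (Γ.graph_point_edist_ne_top p q)
  have L3 : ∀ p, dist (s p) (s (Γ.toSpine N ρ (Γ.toGraph N hρ p))) ≤ 5 * R := fun p =>
    ENNReal.toReal_le_of_le_ofReal (by positivity) (Γ.edist_toSpine_toGraph_le N hρ hρR p)
  have L4 : ∀ p, dist (Γ.graphMk p) (Γ.graphMk (Γ.toGraph N hρ (Γ.toSpine N ρ p))) ≤
      (N : ℝ)⁻¹ * (4 * R) := fun p =>
    ENNReal.toReal_le_of_le_ofReal (by positivity) (Γ.edist_toGraph_toSpine_le N hρ hρR p)
  let Φ : ↥(Set.univ : Set (Rescaled N⁻¹ ((Γ.scale N).GluedSurface ρ))) → Γ.Graph :=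
    fun u => Γ.graphMk (Γ.toGraph N hρ (r u.1.val))
  -- The bound is `ε₁ + ε₂ / 2 + ε₃`: `ε₁ = 0` as `Φ` is defined everywhere, `ε₂` bounds its
  -- distortion, and its image is `ε₃`-dense.
  refine (GromovHausdorff.ghDist_le_of_approx_subsets Φ (ε₁ := 0)
    (ε₂ := (N : ℝ)⁻¹ * (2 * R / m * Metric.diam (Set.univ : Set Γ.Graph) + 10 * R))
    (ε₃ := (N : ℝ)⁻¹ * (4 * R)) (fun u => ⟨u, trivial, by simp⟩) ?_ ?_).trans_eq (by ring)
  · intro g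
    obtain ⟨p, rfl⟩ := Γ.graphMk_surjective g
    refine ⟨⟨⟨s (Γ.toSpine N ρ p)⟩, trivial⟩, ?_⟩
    -- The chosen representative may differ from `toSpine p`, but by `L1` both project to the same
    -- point of the graph.
    have h := L1 (Γ.toSpine N ρ p) (r (s (Γ.toSpine N ρ p)))
    rw [hr, dist_self, mul_zero] at h
    have h2 := dist_triangle (Γ.graphMk p) (Γ.graphMk (Γ.toGraph N hρ (Γ.toSpine N ρ p)))
      (Γ.graphMk (Γ.toGraph N hρ (r (s (Γ.toSpine N ρ p)))))
    exact h2.trans (by linarith [L4 p])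
  · rintro ⟨⟨u⟩, -⟩ ⟨⟨v⟩, -⟩
    change |(((N⁻¹ : PosReal) : ℝ) * dist u v) -
      dist (Γ.graphMk (Γ.toGraph N hρ (r u))) (Γ.graphMk (Γ.toGraph N hρ (r v)))| ≤ _
    rw [Positive.coe_inv]
    have h1 := L1 (r u) (r v)
    have h2 := L2 (Γ.toGraph N hρ (r u)) (Γ.toGraph N hρ (r v))
    have h3 := L3 (r u)
    have h4 := L3 (r v)
    rw [hr] at h3 h4
    rw [hr, hr] at h1
    have h5 := dist_triangle4_right u v (s (Γ.toSpine N ρ (Γ.toGraph N hρ (r u))))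
      (s (Γ.toSpine N ρ (Γ.toGraph N hρ (r v))))
    have h6 : dist (Γ.graphMk (Γ.toGraph N hρ (r u))) (Γ.graphMk (Γ.toGraph N hρ (r v))) ≤
        Metric.diam (Set.univ : Set Γ.Graph) :=
      Metric.dist_le_diam_of_mem isCompact_univ.isBounded trivial trivial
    set D := dist (Γ.graphMk (Γ.toGraph N hρ (r u))) (Γ.graphMk (Γ.toGraph N hρ (r v)))
    have h7 : 2 * R / m * D ≤ 2 * R / m * Metric.diam (Set.univ : Set Γ.Graph) :=
      mul_le_mul_of_nonneg_left h6 (by positivity)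
    -- By `h1` the projection does not increase rescaled distances, so only the upper bound remains;
    -- the `10 * R` in it is the `5 * R` of `L3` at each of `u` and `v`.
    rw [abs_of_nonneg (by linarith)]
    have h8 : dist u v ≤ N * D + (2 * R / m * Metric.diam (Set.univ : Set Γ.Graph) + 10 * R) := by
      linarith
    have h9 := mul_le_mul_of_nonneg_left h8 hN'.le
    rw [mul_add, inv_mul_cancel_left₀ hN.ne'] at h9
    linarith

end MetricRibbonGraph
end

/-! ### Convergence of the rescaled surfaces -/

theorem theorem5p6 {X : Type*} [Fintype X] [Nonempty X] {n : ℕ} (Γ : MetricRibbonGraph X n) :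
    (∀ N : PosReal, ∃! ρ : (Γ.scale N).Vertex → ℝ, (Γ.scale N).IsRibLengths ρ) ∧
    Tendsto
      (fun N : PosReal => GromovHausdorff.toGHSpace (Rescaled N⁻¹ (Γ.scale N).Surface))
      atTop (𝓝 (GromovHausdorff.toGHSpace Γ.Graph)) := by
  refine ⟨fun N => (Γ.scale N).existsUnique_isRibLengths, ?_⟩
  obtain ⟨R, hR, hρR⟩ := Γ.exists_ribLengths_scale_le
  obtain ⟨x₀, hx₀⟩ := Finite.exists_min Γ.len
  set C := (2 * R / Γ.len x₀ * Metric.diam (Set.univ : Set Γ.Graph) + 10 * R) / 2 + 4 * R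
  have hcoe : Tendsto (fun N : PosReal => (N : ℝ)) atTop atTop :=
    tendsto_atTop.2 fun b => (eventually_ge_atTop (⟨max b 1, by positivity⟩ : PosReal)).mono
      fun N hN => (le_max_left b 1).trans hN
  have hlim : Tendsto (fun N : PosReal => (N : ℝ)⁻¹ * C) atTop (𝓝 0) := by
    simpa using (tendsto_inv_atTop_zero.comp hcoe).mul_const C
  rw [tendsto_iff_dist_tendsto_zero]
  -- The estimate is needed only eventually: the uniform bound on ribs holds for `N ≥ 1`.
  refine squeeze_zero' (Eventually.of_forall fun _ => dist_nonneg) ?_ hlim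
  filter_upwards [hcoe.eventually_ge_atTop 1] with N hN
  exact Γ.ghDist_rescaled_le N (Γ.scale N).isRibLengths_ribLengths.1 (hρR N hN) hR
    (Γ.len_pos x₀) hx₀
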